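/- For a prime $q$ let $\chi_q(n)=\left(\frac{n}{q}\right)$ denote the Legendre symbol modulo $q$ (so $\chi_q(n)=0$ if $q\mid n$), and for primes $p,q$ and an integer $a$ put $$\mathrm{test}_a(p,q):=-\chi_q(p)\Bigg(\sum_{\substack{1\le b\le pq\\ b\equiv aq \bmod p}}b^2\chi_q(b)-\sum_{\substack{1\le b\le pq\\ b\equiv -aq \bmod p}}b^2\chi_q(b)\Bigg).$$ If $\mathrm{test}_a(p,q)>0$ for all primes $p<q$ that are both congruent to $3$ modulo $8$ and all integers $a$ with $0<a<p/2$, then the Riemann Hypothesis holds. -/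

import Mathlib

/-- For natural numbers `a`, `p` and a prime `q`, with `χ_q` the Legendre symbol modulo `q`,
the integer
`-χ_q(p) * (∑_{1 ≤ b ≤ pq, b ≡ aq mod p} b² χ_q(b) - ∑_{1 ≤ b ≤ pq, b ≡ -aq mod p} b² χ_q(b))`. -/
def legendreTest (a p q : ℕ) [Fact q.Prime] : ℤ :=
  -legendreSym q (p : ℤ) *
    ((∑ b ∈ (Finset.Icc 1 (p * q)).filter (fun b : ℕ => (b : ℤ) ≡ (a : ℤ) * (q : ℤ) [ZMOD (p : ℤ)]),
        (b : ℤ) ^ 2 * legendreSym q (b : ℤ)) -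
      ∑ b ∈ (Finset.Icc 1 (p * q)).filter
          (fun b : ℕ => (b : ℤ) ≡ -((a : ℤ) * (q : ℤ)) [ZMOD (p : ℤ)]),
        (b : ℤ) ^ 2 * legendreSym q (b : ℤ))

/-!
The hypothesis forces the sine series of the Liouville function `λ` to be nonnegative on
`[0, 1/2]`, and Landau's theorem on Mellin transforms of nonnegative functions converts this into a
zero-free half-plane for `ζ`.

*From the test to a sine series.* Expanding the second Bernoulli polynomial in its Fourier series
and evaluating the finite Fourier transform of `χ_q` along residue classes modulo `p`
(`legendreTest_eq`) gives `test_a(p, q) = K * t * F_q(a / p)`, where `K > 0`, `i t` is the Gauss sum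
of `χ_q` and `F_q(x) = ∑ χ_q(n) sin (2 π n x) / n ^ 2`. Gauss' determination of the sign of `t` is
not needed: `F_q(1 / 3) > 0` because its first term dominates, so the case `p = 3` of the hypothesis
yields `t > 0`. Hence `F_q(a / p) > 0` for all admissible `p`, `q`, `a`.

*From `χ_q` to `λ`.* By quadratic reciprocity and Dirichlet's theorem there are primes
`q ≡ 3 mod 8` with `χ_q(l) = -1` for all primes `l ≤ N`, so that `χ_q` and `λ` agree up to `N`.
Letting `N → ∞`, and using that the fractions `a / p` are dense in `[0, 1/2]`, one gets
`∑ λ(n) sin (2 π n x) / n ^ 2 ≥ 0` on `[0, 1/2]` (`sineSeries_liouville_nonneg`).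

*From positivity to zeros.* Integrating against `exp (-τ x)` over a period turns this into
`Q(u) = ∑ λ(n) / (n (n ^ 2 + u)) ≥ 0` for `u > 0` (`tsum_div_nonneg_of_sineSeries_nonneg`). For
`0 < re z < 1` the Mellin transform of `Q` is `Γ(z) Γ(1 - z) ζ(6 - 4 z) / ζ(3 - 2 z)`
(`riemannZeta₁_mul_mellin_liouville`). This function has no singularity at the real points of
`(0, 5/4)`, since `(s - 1) ζ(s)` has no zero in `(0, 3)` (`riemannZeta₁_ofReal_ne_zero`), so by
Landau's theorem (`Ioo_subset_integrableExpSet_of_mul_complexMGF_eq`) the Mellin integral converges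
and is holomorphic for `0 < re z < 5/4`. A zero of `ζ` with real part in `(1/2, 1)` would be a pole.
The functional equation takes care of the zeros to the left of the critical line.
-/

/-! ### Landau's theorem for moment generating functions -/

section

open MeasureTheory ProbabilityTheory Complex

/-- The local step of Landau's argument: if the moment generating function of `X` is finite just to
the left of `σ` and agrees there with a function holomorphic on a disc around `σ`, then it is finite
at some point to the right of `σ`. The Taylor series of `H` at a point `s₀ < σ` converges beyond
`σ`; its terms of even order are integrals of nonnegative functions, which sum to
`cosh (δ X) * exp (s₀ X)`. -/
theorem exists_gt_mem_integrableExpSet {Ω : Type*} [MeasurableSpace Ω] {μ : Measure Ω} {X : Ω → ℝ}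
    (hX : Measurable X) {σ r : ℝ} (hr : 0 < r) {H : ℂ → ℂ}
    (hH : DifferentiableOn ℂ H (Metric.ball (σ : ℂ) r))
    (hI : Set.Ioo (σ - r) σ ⊆ integrableExpSet X μ)
    (hEq : ∀ t ∈ Set.Ioo (σ - r) σ, complexMGF X μ =ᶠ[nhds (t : ℂ)] H) :
    ∃ s > σ, s ∈ integrableExpSet X μ := by
  -- With `ε = r / 3`, the disc of radius `2 ε` around `s₀ = σ - ε` lies in the given disc and
  -- contains `s₀ + δ = σ + ε / 2`.
  set ε := r / 3 with hε
  have hε0 : 0 < ε := by positivity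
  set s₀ := σ - ε with hs₀
  set δ := 3 * ε / 2 with hδ
  have hs₀I : s₀ ∈ Set.Ioo (σ - r) σ := ⟨by linarith, by linarith⟩
  have hint : s₀ ∈ interior (integrableExpSet X μ) :=
    interior_mono hI (by rwa [isOpen_Ioo.interior_eq])
  have hsub : Metric.ball (s₀ : ℂ) (2 * ε) ⊆ Metric.ball (σ : ℂ) r := by
    apply Metric.ball_subset_ball'
    rw [Complex.dist_eq, ← ofReal_sub, Complex.norm_real, Real.norm_eq_abs, abs_of_neg] <;> linarith
  have hz : ((s₀ + δ : ℝ) : ℂ) ∈ Metric.ball (s₀ : ℂ) (2 * ε) := by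
    rw [Metric.mem_ball, Complex.dist_eq, ← ofReal_sub, Complex.norm_real, Real.norm_eq_abs,
      abs_of_pos] <;> linarith
  have hT := Complex.hasSum_taylorSeries_on_ball (hH.mono hsub) hz
  set m : ℕ → ℝ := fun n => ∫ ω, X ω ^ n * Real.exp (s₀ * X ω) ∂μ with hm
  have hder (n : ℕ) : iteratedDeriv n H (s₀ : ℂ) = (m n : ℂ) := by
    rw [← (hEq s₀ hs₀I).iteratedDeriv_eq n, iteratedDeriv_complexMGF (by simpa using hint), hm]
    push_cast [← integral_complex_ofReal]
    rfl
  have hsum : Summable fun n : ℕ => δ ^ n / n.factorial * m n := by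
    have h1 := hT.summable
    simp only [hder] at h1
    rw [← Complex.summable_ofReal]
    refine h1.congr fun n => ?_
    push_cast
    simp only [smul_eq_mul]
    ring
  have hsum2 : Summable fun n : ℕ => δ ^ (2 * n) / (2 * n).factorial * m (2 * n) :=
    hsum.comp_injective (i := fun n : ℕ => 2 * n) fun a b h => by simpa using h
  have hmint (n : ℕ) : Integrable (fun ω => X ω ^ n * Real.exp (s₀ * X ω)) μ :=
    integrable_pow_mul_exp_of_mem_interior_integrableExpSet hint n
  have hcosh : Integrable (fun ω => Real.cosh (δ * X ω) * Real.exp (s₀ * X ω)) μ := by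
    refine ⟨by fun_prop, ?_⟩
    rw [hasFiniteIntegral_iff_ofReal (.of_forall fun ω =>
      mul_nonneg (Real.cosh_pos _).le (Real.exp_pos _).le)]
    have hpt (ω : Ω) : ENNReal.ofReal (Real.cosh (δ * X ω) * Real.exp (s₀ * X ω)) =
        ∑' n : ℕ, ENNReal.ofReal
          (δ ^ (2 * n) / (2 * n).factorial * (X ω ^ (2 * n) * Real.exp (s₀ * X ω))) := by
      have h := (Real.hasSum_cosh (δ * X ω)).mul_right (Real.exp (s₀ * X ω))
      rw [← ENNReal.ofReal_tsum_of_nonneg]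
      · rw [← h.tsum_eq]
        congr 1
        exact tsum_congr fun n => by rw [mul_pow]; ring
      · intro n
        have : 0 ≤ X ω ^ (2 * n) := by rw [pow_mul]; positivity
        positivity
      · exact h.summable.congr fun n => by rw [mul_pow]; ring
    simp_rw [hpt]
    rw [lintegral_tsum (fun n => by fun_prop)]
    have hterm (n : ℕ) : ∫⁻ ω, ENNReal.ofReal
          (δ ^ (2 * n) / (2 * n).factorial * (X ω ^ (2 * n) * Real.exp (s₀ * X ω))) ∂μ =
        ENNReal.ofReal (δ ^ (2 * n) / (2 * n).factorial * m (2 * n)) := by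
      rw [← ofReal_integral_eq_lintegral_ofReal ((hmint _).const_mul _), integral_const_mul]
      refine .of_forall fun ω => ?_
      have : 0 ≤ X ω ^ (2 * n) := by rw [pow_mul]; positivity
      positivity
    simp_rw [hterm]
    exact hsum2.tsum_ofReal_lt_top
  refine ⟨s₀ + δ, by linarith, ?_⟩
  refine (hcosh.const_mul 2).mono (by fun_prop) (.of_forall fun ω => ?_)
  rw [Real.norm_of_nonneg (Real.exp_pos _).le, Real.norm_of_nonneg
    (mul_nonneg zero_le_two (mul_nonneg (Real.cosh_pos _).le (Real.exp_pos _).le)),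
    add_comm s₀, add_mul, Real.exp_add, ← mul_assoc]
  gcongr
  rw [Real.cosh_eq]
  linarith [Real.exp_pos (-(δ * X ω))]

/-- Two functions holomorphic on a vertical strip that agree on a left part of it agree. -/
theorem eqOn_strip_of_eqOn_left {F G : ℂ → ℂ} {a b c : ℝ} (hac : a < c) (hcb : c ≤ b)
    (hF : DifferentiableOn ℂ F {z | a < z.re ∧ z.re < b})
    (hG : DifferentiableOn ℂ G {z | a < z.re ∧ z.re < b})
    (h : Set.EqOn F G {z | a < z.re ∧ z.re < c}) :
    Set.EqOn F G {z | a < z.re ∧ z.re < b} := by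
  have hopen (d : ℝ) : IsOpen {z : ℂ | a < z.re ∧ z.re < d} :=
    (isOpen_lt continuous_const continuous_re).inter (isOpen_lt continuous_re continuous_const)
  have hconv : Convex ℝ {z : ℂ | a < z.re ∧ z.re < b} :=
    (convex_halfSpace_re_gt a).inter (convex_halfSpace_re_lt b)
  have hmem : (((a + c) / 2 : ℝ) : ℂ) ∈ {z : ℂ | a < z.re ∧ z.re < c} := by
    constructor <;> rw [ofReal_re] <;> linarith
  refine (hF.analyticOnNhd (hopen b)).eqOn_of_preconnected_of_eventuallyEq
    (hG.analyticOnNhd (hopen b)) hconv.isPreconnected ⟨hmem.1, hmem.2.trans_le hcb⟩ ?_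
  filter_upwards [(hopen c).mem_nhds hmem] with z hz using h hz

/-- **Landau's theorem** for moment generating functions: if the complex moment generating function
equals a quotient `N / D` on the strip `a < re z < c`, where `N` and `D` are holomorphic on the
larger strip `a < re z < b` and `D` has no zero on the real segment `(a, b)`, then it is finite on
the larger strip, and the identity persists there. -/
theorem Ioo_subset_integrableExpSet_of_mul_complexMGF_eq {Ω : Type*} [MeasurableSpace Ω]
    {μ : Measure Ω} {X : Ω → ℝ} (hX : Measurable X) {a b c : ℝ} (hac : a < c) (hcb : c ≤ b)
    {N D : ℂ → ℂ} (hN : DifferentiableOn ℂ N {z | a < z.re ∧ z.re < b})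
    (hD : Differentiable ℂ D) (hD0 : ∀ t ∈ Set.Ioo a b, D (t : ℂ) ≠ 0)
    (hI : Set.Ioo a c ⊆ integrableExpSet X μ)
    (h : ∀ z : ℂ, a < z.re → z.re < c → D z * complexMGF X μ z = N z) :
    Set.Ioo a b ⊆ integrableExpSet X μ ∧
      ∀ z : ℂ, a < z.re → z.re < b → D z * complexMGF X μ z = N z := by
  -- Finiteness on `(a, d)` extends the identity to the strip `a < re z < d`.
  have key (d : ℝ) (hcd : c ≤ d) (hdb : d ≤ b) (hd : Set.Ioo a d ⊆ integrableExpSet X μ) :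
      ∀ z : ℂ, a < z.re → z.re < d → D z * complexMGF X μ z = N z := by
    have hdiff : DifferentiableOn ℂ (fun z => D z * complexMGF X μ z)
        {z | a < z.re ∧ z.re < d} := by
      refine hD.differentiableOn.mul (differentiableOn_complexMGF.mono fun z hz => ?_)
      exact interior_mono hd (by rw [isOpen_Ioo.interior_eq]; exact hz)
    intro z hz1 hz2
    exact eqOn_strip_of_eqOn_left hac hcd hdiff (hN.mono fun z hz => ⟨hz.1, hz.2.trans_le hdb⟩)
      (fun z hz => h z hz.1 hz.2) ⟨hz1, hz2⟩
  suffices hsub : Set.Ioo a b ⊆ integrableExpSet X μ from ⟨hsub, key b hcb le_rfl hsub⟩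
  have hconn : (integrableExpSet X μ).OrdConnected := convex_integrableExpSet.ordConnected
  by_contra hnot
  obtain ⟨s₁, hs₁, hs₁J⟩ := Set.not_subset.mp hnot
  have hm : (a + c) / 2 ∈ integrableExpSet X μ := hI ⟨by linarith, by linarith⟩
  have hs₁c : c ≤ s₁ := by
    by_contra hlt
    exact hs₁J (hI ⟨hs₁.1, not_le.mp hlt⟩)
  have hub : s₁ ∈ upperBounds (integrableExpSet X μ) := fun x hx => by
    by_contra hlt
    exact hs₁J (hconn.out hm hx ⟨by linarith, (not_le.mp hlt).le⟩)
  -- The abscissa of convergence; the local step shows that it cannot be less than `b`.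
  set σ := sSup (integrableExpSet X μ) with hσ
  have hbdd : BddAbove (integrableExpSet X μ) := ⟨s₁, hub⟩
  have hσs₁ : σ ≤ s₁ := csSup_le ⟨_, hm⟩ hub
  have hcσ : c ≤ σ := le_of_forall_lt fun t ht => by
    rcases le_or_gt t ((a + c) / 2) with h1 | h1
    · exact (show t < (((a + c) / 2) + c) / 2 by linarith).trans_le
        (le_csSup hbdd (hI ⟨by linarith, by linarith⟩))
    · exact (show t < (t + c) / 2 by linarith).trans_le
        (le_csSup hbdd (hI ⟨by linarith, by linarith⟩))
  have hσb : σ < b := hσs₁.trans_lt hs₁.2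
  have hσI : Set.Ioo a σ ⊆ integrableExpSet X μ := fun t ht => by
    rcases lt_or_ge t c with h1 | h1
    · exact hI ⟨ht.1, h1⟩
    · obtain ⟨x, hx, htx⟩ := exists_lt_of_lt_csSup ⟨_, hm⟩ ht.2
      exact hconn.out hm hx ⟨by linarith, htx.le⟩
  have hid := key σ hcσ hσb.le hσI
  have hne : ∀ᶠ z in nhds (σ : ℂ), D z ≠ 0 ∧ z ∈ {z : ℂ | a < z.re ∧ z.re < b} :=
    (hD.continuous.continuousAt.eventually_ne (hD0 σ ⟨by linarith, hσb⟩)).and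
      (((isOpen_lt continuous_const continuous_re).inter
        (isOpen_lt continuous_re continuous_const)).mem_nhds
          ⟨show a < (σ : ℂ).re by rw [ofReal_re]; linarith,
            show (σ : ℂ).re < b by rwa [ofReal_re]⟩)
  obtain ⟨r, hr, hball⟩ := Metric.eventually_nhds_iff_ball.mp hne
  have hmemball {t : ℝ} (ht : t ∈ Set.Ioo (σ - r) σ) : (t : ℂ) ∈ Metric.ball (σ : ℂ) r := by
    rw [Metric.mem_ball, Complex.dist_eq, ← ofReal_sub, Complex.norm_real, Real.norm_eq_abs,
      abs_of_neg] <;> linarith [ht.1, ht.2]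
  have hat {t : ℝ} (ht : t ∈ Set.Ioo (σ - r) σ) : a < t := by
    simpa using (hball _ (hmemball ht)).2.1
  obtain ⟨s, hs, hsJ⟩ := exists_gt_mem_integrableExpSet (H := fun z => N z / D z) hX hr
    ((hN.mono fun z hz => (hball z hz).2).div hD.differentiableOn fun z hz => (hball z hz).1)
    (fun t ht => hσI ⟨hat ht, ht.2⟩) (fun t ht => by
      filter_upwards [Metric.isOpen_ball.mem_nhds (hmemball ht),
        (isOpen_lt continuous_re continuous_const).mem_nhds
          (show (t : ℂ).re < σ by rw [ofReal_re]; exact ht.2)] with z hz hzσ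
      rw [eq_div_iff (hball z hz).1, mul_comm]
      exact hid z (hball z hz).2.1 hzσ)
  exact absurd (le_csSup hbdd hsJ) (not_le.mpr hs)

end

/-! ### The Dirichlet series of the Liouville function -/

/-- The Liouville function `n ↦ (-1) ^ Ω n`, with value `0` at `0`. -/
noncomputable def liouvilleHom : ℕ →*₀ ℝ where
  toFun n := if n = 0 then 0 else (-1) ^ ArithmeticFunction.cardFactors n
  map_zero' := by simp
  map_one' := by simp
  map_mul' m n := by
    rcases eq_or_ne m 0 with rfl | hm
    · simp
    rcases eq_or_ne n 0 with rfl | hn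
    · simp
    simp [hm, hn, ArithmeticFunction.cardFactors_mul hm hn, pow_add]

theorem liouvilleHom_apply_prime {p : ℕ} (hp : p.Prime) : liouvilleHom p = -1 := by
  change (if p = 0 then (0 : ℝ) else (-1) ^ ArithmeticFunction.cardFactors p) = -1
  simp [hp.ne_zero, ArithmeticFunction.cardFactors_apply_prime hp]

theorem abs_liouvilleHom_le_one (n : ℕ) : |liouvilleHom n| ≤ 1 := by
  change |if n = 0 then (0 : ℝ) else (-1) ^ ArithmeticFunction.cardFactors n| ≤ 1
  split_ifs <;> simp

/-- The Dirichlet series of the Liouville function is `ζ(2s) / ζ(s)`: multiply the Euler factors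
`(1 + p ^ (-s))⁻¹ * (1 - p ^ (-s))⁻¹ = (1 - p ^ (-2 * s))⁻¹`. -/
theorem tsum_liouvilleHom_mul_riemannZeta {s : ℂ} (hs : 1 < s.re) :
    (∑' n : ℕ, (liouvilleHom n : ℂ) * (n : ℂ) ^ (-s)) * riemannZeta s = riemannZeta (2 * s) := by
  let f : ℕ →*₀ ℂ := (Complex.ofRealHom.toMonoidWithZeroHom).comp liouvilleHom *
    riemannZetaSummandHom (Complex.ne_zero_of_one_lt_re hs)
  have hf (n : ℕ) : f n = (liouvilleHom n : ℂ) * (n : ℂ) ^ (-s) := rfl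
  have hsum : Summable (‖f ·‖) := by
    refine (summable_riemannZetaSummand hs).of_nonneg_of_le (fun _ => norm_nonneg _) fun n => ?_
    rw [hf, norm_mul, Complex.norm_real]
    exact mul_le_of_le_one_left (norm_nonneg _) (abs_liouvilleHom_le_one n)
  have h1 := EulerProduct.eulerProduct_completely_multiplicative_hasProd hsum
  have h2 := riemannZeta_eulerProduct_hasProd hs
  have h3 := riemannZeta_eulerProduct_hasProd (s := 2 * s) (by simp; linarith)
  refine (h1.mul h2).unique (h3.congr_fun fun p => ?_)
  rw [hf, liouvilleHom_apply_prime p.2, ← mul_inv, show -(2 * s) = -s + -s by ring,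
    Complex.cpow_add _ _ (by exact_mod_cast p.2.ne_zero)]
  congr 1
  push_cast
  ring

/-! ### Nonvanishing of `(s - 1) ζ(s)` on `(0, 3)` -/

section

open MeasureTheory ProbabilityTheory Complex

/-- The measure `g t / t dt` on `(0, ∞)`. The moment generating function of `Real.log` with respect
to it is the Mellin transform of `g`. -/
noncomputable def mellinMeasure (g : ℝ → ℝ) : Measure ℝ :=
  (volume.restrict (Set.Ioi 0)).withDensity fun t => ENNReal.ofReal (g t / t)

theorem exp_mul_log_mul_div {t : ℝ} (ht : 0 < t) (z x : ℂ) :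
    (x / t) * exp (z * Real.log t) = t ^ (z - 1) * x := by
  have ht' : (t : ℂ) ≠ 0 := by exact_mod_cast ht.ne'
  rw [cpow_sub _ _ ht', cpow_one, cpow_def_of_ne_zero ht', ofReal_log ht.le, mul_comm z]
  ring

theorem complexMGF_log_mellinMeasure {g : ℝ → ℝ} (hg : Measurable g) (hg0 : ∀ t > 0, 0 ≤ g t)
    (z : ℂ) : complexMGF Real.log (mellinMeasure g) z = mellin (fun t => (g t : ℂ)) z := by
  rw [complexMGF, mellinMeasure, integral_withDensity_eq_integral_toReal_smul (by fun_prop)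
    (.of_forall fun _ => ENNReal.ofReal_lt_top), mellin]
  refine setIntegral_congr_fun measurableSet_Ioi fun t ht => ?_
  simp only [smul_eq_mul, ENNReal.toReal_ofReal (div_nonneg (hg0 t ht) (le_of_lt ht)), real_smul,
    ofReal_div]
  exact exp_mul_log_mul_div ht z (g t)

theorem mem_integrableExpSet_log_mellinMeasure {g : ℝ → ℝ} (hg : Measurable g)
    (hg0 : ∀ t > 0, 0 ≤ g t) {s : ℝ} (h : MellinConvergent (fun t => (g t : ℂ)) s) :
    s ∈ integrableExpSet Real.log (mellinMeasure g) := by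
  rw [integrableExpSet, Set.mem_ofPred_eq, mellinMeasure,
    integrable_withDensity_iff_integrable_smul' (by fun_prop)
      (.of_forall fun _ => ENNReal.ofReal_lt_top)]
  have hc : IntegrableOn (fun t : ℝ =>
      (((ENNReal.ofReal (g t / t)).toReal • Real.exp (s * Real.log t) : ℝ) : ℂ)) (Set.Ioi 0) := by
    refine IntegrableOn.congr_fun h (fun t ht => ?_) measurableSet_Ioi
    simp only [smul_eq_mul, ENNReal.toReal_ofReal (div_nonneg (hg0 t ht) (le_of_lt ht)),
      ofReal_mul, ofReal_div, ofReal_exp]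
    exact (exp_mul_log_mul_div ht s (g t)).symm
  exact hc.re

/-- The fractional part, cut off to `(1, ∞)`. -/
noncomputable def fractIndicator : ℝ → ℝ := (Set.Ioi 1).indicator Int.fract

theorem measurable_fractIndicator : Measurable fractIndicator :=
  measurable_fract.indicator measurableSet_Ioi

theorem fractIndicator_nonneg (t : ℝ) : 0 ≤ fractIndicator t :=
  Set.indicator_nonneg (fun _ _ => Int.fract_nonneg _) t

theorem integrableOn_cpow_mul_fract {z : ℂ} (hz : z.re < 0) :
    IntegrableOn (fun t : ℝ => (t : ℂ) ^ (z - 1) * (Int.fract t : ℝ)) (Set.Ioi 1) := by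
  refine (integrableOn_Ioi_cpow_of_lt (a := z - 1) (by rw [sub_re, one_re]; linarith) one_pos).mul_bdd
    (c := 1) (by fun_prop) (.of_forall fun t => ?_)
  rw [norm_real, Real.norm_of_nonneg (Int.fract_nonneg _)]
  exact (Int.fract_lt_one t).le

theorem cpow_smul_fractIndicator (z : ℂ) :
    (fun t : ℝ => (t : ℂ) ^ (z - 1) • (fractIndicator t : ℂ)) =
      (Set.Ioi 1).indicator fun t : ℝ => (t : ℂ) ^ (z - 1) * (Int.fract t : ℝ) := by
  ext t
  by_cases ht : t ∈ Set.Ioi 1 <;> simp [fractIndicator, ht]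

theorem mellinConvergent_fractIndicator {z : ℂ} (hz : z.re < 0) :
    MellinConvergent (fun t => (fractIndicator t : ℂ)) z := by
  rw [MellinConvergent, cpow_smul_fractIndicator]
  exact ((integrable_indicator_iff measurableSet_Ioi).mpr
    (integrableOn_cpow_mul_fract hz)).integrableOn

theorem mellin_fractIndicator (z : ℂ) : mellin (fun t => (fractIndicator t : ℂ)) z =
    ∫ t in Set.Ioi (1 : ℝ), (t : ℂ) ^ (z - 1) * (Int.fract t : ℝ) := by
  rw [mellin, cpow_smul_fractIndicator, setIntegral_indicator measurableSet_Ioi,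
    Set.inter_eq_right.mpr (Set.Ioi_subset_Ioi zero_le_one)]

/-- Abel summation: `ζ(s) = s ∫ ⌊t⌋ t ^ (-s - 1)` over `(1, ∞)`, with `⌊t⌋ = t - fract t` and both
sides multiplied by `s - 1`. -/
theorem riemannZeta₁_eq_of_one_lt_re {s : ℂ} (hs : 1 < s.re) :
    riemannZeta₁ s =
      s - s * (s - 1) * mellin (fun t => (fractIndicator t : ℂ)) (-s) := by
  have hs1 : s ≠ 1 := by rintro rfl; simp at hs
  have hs1' : s - 1 ≠ 0 := sub_ne_zero.mpr hs1
  have h1 := LSeries_eq_mul_integral_of_nonneg (fun _ => 1) (r := 1) zero_le_one hs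
    (by simpa using Asymptotics.isBigO_refl _ _) (fun _ => zero_le_one)
  have h2 : LSeries (fun _ => ((1 : ℝ) : ℂ)) s = riemannZeta s := by
    rw [← LSeries_one_eq_riemannZeta hs]
    congr 1
  have h3 : ∫ t in Set.Ioi (1 : ℝ), (∑ _k ∈ Finset.Icc 1 ⌊t⌋₊, ((1 : ℝ) : ℂ)) * t ^ (-(s + 1)) =
      (s - 1)⁻¹ - mellin (fun t => (fractIndicator t : ℂ)) (-s) := by
    have h4 : ∫ t in Set.Ioi (1 : ℝ), (t : ℂ) ^ (-s) = (s - 1)⁻¹ := by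
      rw [integral_Ioi_cpow_of_lt (by simpa using hs) one_pos, ofReal_one, one_cpow,
        neg_div, ← div_neg, one_div]
      congr 1
      ring
    rw [← h4, mellin_fractIndicator, ← integral_sub
      (integrableOn_Ioi_cpow_of_lt (by simpa using hs) one_pos)
      (integrableOn_cpow_mul_fract (by rw [neg_re]; linarith))]
    refine setIntegral_congr_fun measurableSet_Ioi fun t (ht : 1 < t) => ?_
    have ht0 : (t : ℂ) ≠ 0 := by exact_mod_cast (one_pos.trans ht).ne'
    have hfl : ((⌊t⌋₊ : ℝ) : ℂ) = t - (Int.fract t : ℝ) := by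
      rw [← ofReal_sub, Int.self_sub_fract, natCast_floor_eq_intCast_floor (one_pos.trans ht).le]
    simp only [ofReal_one, Finset.sum_const, Nat.card_Icc, add_tsub_cancel_right, nsmul_eq_mul,
      mul_one]
    rw [← ofReal_natCast, hfl, show -(s + 1) = -s - 1 by ring, cpow_sub _ _ ht0, cpow_one]
    field_simp
  rw [h2, h3, riemannZeta_eq_inv_sub_mul hs1] at h1
  field_simp at h1
  linear_combination h1

/-- The entire function `(s - 1) ζ(s)` has no zero on the real interval `(0, 3)`. For `0 < s < 1`
this follows from `(s - 1) ζ(s) = s + s (1 - s) ∫ fract t * t ^ (-s - 1)` over `(1, ∞)`, where both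
summands are nonnegative. -/
theorem riemannZeta₁_ofReal_ne_zero {s : ℝ} (hs0 : 0 < s) (hs3 : s < 3) :
    riemannZeta₁ s ≠ 0 := by
  rcases le_or_gt 1 s with hs1 | hs1
  · rcases hs1.eq_or_lt with rfl | hs1
    · simp
    · have hne : (s : ℂ) ≠ 1 := by exact_mod_cast hs1.ne'
      intro h
      have := riemannZeta_eq_inv_sub_mul hne
      rw [h, mul_zero] at this
      exact riemannZeta_ne_zero_of_one_le_re (by simpa using hs1.le) this
  -- The identity for `1 < re s < 3` extends to `0 < re s < 3`, as the Mellin transform of the fractional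
  -- part is holomorphic there. The variable is `z = -s`.
  set M := complexMGF Real.log (mellinMeasure fractIndicator) with hM
  have hmem : Set.Ioo (-3) 0 ⊆ integrableExpSet Real.log (mellinMeasure fractIndicator) :=
    fun t ht => mem_integrableExpSet_log_mellinMeasure measurable_fractIndicator
      (fun t _ => fractIndicator_nonneg t) (mellinConvergent_fractIndicator (by simpa using ht.2))
  have hMdiff : DifferentiableOn ℂ M {z | -3 < z.re ∧ z.re < 0} :=
    differentiableOn_complexMGF.mono fun z hz =>
      interior_mono hmem (by rw [isOpen_Ioo.interior_eq]; exact hz)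
  have hid : Set.EqOn (fun z => riemannZeta₁ (-z))
      (fun z => -z - z * (z + 1) * M z) {z | -3 < z.re ∧ z.re < 0} := by
    refine eqOn_strip_of_eqOn_left (c := -1) (by norm_num) (by norm_num) ?_ ?_ ?_
    · exact (differentiable_riemannZeta₁.comp differentiable_neg).differentiableOn
    · exact differentiable_neg.differentiableOn.sub
        (DifferentiableOn.mul (by fun_prop) hMdiff)
    · intro z hz
      simp only
      rw [riemannZeta₁_eq_of_one_lt_re (by rw [neg_re]; linarith [hz.2]), neg_neg, hM,
        complexMGF_log_mellinMeasure measurable_fractIndicator (fun t _ => fractIndicator_nonneg t)]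
      ring
  have h := hid (x := ((-s : ℝ) : ℂ)) ⟨by rw [ofReal_re]; linarith, by rw [ofReal_re]; linarith⟩
  simp only [hM, complexMGF_ofReal] at h
  rw [ofReal_neg, neg_neg] at h
  rw [h]
  have hmgf : 0 ≤ mgf Real.log (mellinMeasure fractIndicator) (-s) := mgf_nonneg
  have hpos : 0 < s + s * (1 - s) * mgf Real.log (mellinMeasure fractIndicator) (-s) := by
    have := mul_nonneg (mul_nonneg hs0.le (sub_nonneg.mpr hs1.le)) hmgf
    linarith
  intro h0
  refine hpos.ne' ?_
  have : ((s + s * (1 - s) * mgf Real.log (mellinMeasure fractIndicator) (-s) : ℝ) : ℂ) = 0 := by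
    rw [← h0]
    push_cast
    ring
  exact_mod_cast this

end

/-! ### Sine series and their Laplace transforms -/

open Real in
/-- The series `∑ c n * sin (2 π n x) / n ^ 2`. -/
noncomputable def sineSeries (c : ℕ → ℝ) (x : ℝ) : ℝ :=
  ∑' n : ℕ, c n / (n : ℝ) ^ 2 * Real.sin (2 * π * n * x)

section
open Real

theorem norm_sineSeries_term_le {c : ℕ → ℝ} (hc : ∀ n, |c n| ≤ 1) (n : ℕ) (x : ℝ) :
    ‖c n / (n : ℝ) ^ 2 * Real.sin (2 * π * n * x)‖ ≤ 1 / (n : ℝ) ^ 2 := by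
  rw [norm_mul, norm_div, Real.norm_of_nonneg (by positivity : (0 : ℝ) ≤ (n : ℝ) ^ 2)]
  refine (mul_le_of_le_one_right (by positivity) (abs_sin_le_one _)).trans ?_
  gcongr
  exact hc n

theorem summable_one_div_nat_sq : Summable fun n : ℕ => 1 / (n : ℝ) ^ 2 :=
  Real.summable_one_div_nat_pow.mpr one_lt_two

theorem summable_sineSeries {c : ℕ → ℝ} (hc : ∀ n, |c n| ≤ 1) (x : ℝ) :
    Summable fun n : ℕ => c n / (n : ℝ) ^ 2 * Real.sin (2 * π * n * x) :=
  summable_one_div_nat_sq.of_norm_bounded fun n => norm_sineSeries_term_le hc n x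

theorem continuous_sineSeries {c : ℕ → ℝ} (hc : ∀ n, |c n| ≤ 1) : Continuous (sineSeries c) :=
  continuous_tsum (fun n => by fun_prop) summable_one_div_nat_sq
    fun n x => norm_sineSeries_term_le hc n x

theorem sineSeries_one_sub (c : ℕ → ℝ) (x : ℝ) : sineSeries c (1 - x) = -sineSeries c x := by
  rw [sineSeries, sineSeries, ← tsum_neg]
  refine tsum_congr fun n => ?_
  rw [show 2 * π * n * (1 - x) = n * (2 * π) - 2 * π * n * x by ring,
    Real.sin_nat_mul_two_pi_sub]
  ring

theorem integral_sin_mul_exp_neg {τ : ℝ} (hτ : 0 < τ) (n : ℕ) :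
    ∫ x in (0 : ℝ)..1, Real.sin (2 * π * n * x) * rexp (-τ * x) =
      (1 - rexp (-τ)) * (2 * π * n) / (τ ^ 2 + (2 * π * n) ^ 2) := by
  set ω : ℝ := 2 * π * n with hω
  have hne : τ ^ 2 + ω ^ 2 ≠ 0 := by positivity
  have hderiv (x : ℝ) : HasDerivAt
      (fun x => -(τ * Real.sin (ω * x) + ω * Real.cos (ω * x)) * rexp (-τ * x) / (τ ^ 2 + ω ^ 2))
      (Real.sin (ω * x) * rexp (-τ * x)) x := by
    have h1 : HasDerivAt (fun x => ω * x) ω x := by simpa using (hasDerivAt_id x).const_mul ω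
    have h2 : HasDerivAt (fun x => -τ * x) (-τ) x := by simpa using (hasDerivAt_id x).const_mul (-τ)
    have h := ((((h1.sin.const_mul τ).add (h1.cos.const_mul ω)).neg.mul h2.exp).div_const
      (τ ^ 2 + ω ^ 2))
    refine h.congr_deriv ?_
    simp only [Pi.add_apply, Pi.neg_apply]
    field_simp
    ring
  rw [intervalIntegral.integral_eq_sub_of_hasDerivAt (fun x _ => hderiv x)
    (by apply Continuous.intervalIntegrable; fun_prop)]
  have hs : Real.sin ω = 0 := by
    rw [hω, mul_comm (2 * π), ← mul_assoc, mul_comm, ← mul_assoc]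
    simpa [mul_comm, mul_assoc] using Real.sin_nat_mul_pi (2 * n)
  have hcs : Real.cos ω = 1 := by
    rw [hω, mul_comm]
    exact Real.cos_nat_mul_two_pi n
  simp only [mul_one, mul_zero, hs, hcs, Real.sin_zero, Real.cos_zero, Real.exp_zero]
  field_simp
  ring

/-- The Laplace transform over one period: up to positive factors,
`∫ (x in 0..1), F x * exp (-τ x) = ∑ c n / (n * (n ^ 2 + u))` with `τ = 2 π √u`. -/
theorem integral_sineSeries_mul_exp {c : ℕ → ℝ} (hc : ∀ n, |c n| ≤ 1) {u : ℝ} (hu : 0 < u) :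
    ∫ x in (0 : ℝ)..1, sineSeries c x * rexp (-(2 * π * √u) * x) =
      (1 - rexp (-(2 * π * √u))) / (2 * π) * ∑' n : ℕ, c n / n / ((n : ℝ) ^ 2 + u) := by
  set τ := 2 * π * √u with hτ
  have hτ0 : 0 < τ := by positivity
  let f : ℕ → C(ℝ, ℝ) := fun n =>
    ⟨fun x => c n / (n : ℝ) ^ 2 * Real.sin (2 * π * n * x) * rexp (-τ * x), by fun_prop⟩
  have hsum : Summable fun n => ‖(f n).restrict (⟨Set.uIcc 0 1, isCompact_uIcc⟩ :
      TopologicalSpace.Compacts ℝ)‖ := by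
    refine summable_one_div_nat_sq.of_nonneg_of_le (fun _ => norm_nonneg _) fun n => ?_
    rw [ContinuousMap.norm_le _ (by positivity)]
    rintro ⟨x, hx⟩
    have hx' : x ∈ Set.Icc (0 : ℝ) 1 := by simpa using hx
    simp only [f, ContinuousMap.restrict_apply, ContinuousMap.coe_mk]
    rw [norm_mul, Real.norm_of_nonneg (Real.exp_pos _).le]
    refine (mul_le_of_le_one_right (norm_nonneg _) ?_).trans (norm_sineSeries_term_le hc n x)
    rw [Real.exp_le_one_iff]
    nlinarith [hx'.1]
  have h := intervalIntegral.hasSum_intervalIntegral_of_summable_norm hsum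
  have h1 : ∀ x, ∑' n, f n x = sineSeries c x * rexp (-τ * x) := fun x => by
    rw [sineSeries, ← tsum_mul_right]
    rfl
  simp only [h1] at h
  rw [← h.tsum_eq, ← tsum_mul_left]
  refine tsum_congr fun n => ?_
  simp only [f, ContinuousMap.coe_mk, mul_assoc]
  rw [intervalIntegral.integral_const_mul]
  have := integral_sin_mul_exp_neg hτ0 n
  simp only [mul_assoc] at this
  rw [this]
  rcases eq_or_ne n 0 with rfl | hn
  · simp
  have hn' : (n : ℝ) ≠ 0 := by exact_mod_cast hn
  have hsq : τ ^ 2 = 4 * π ^ 2 * u := by rw [hτ, mul_pow, mul_pow, Real.sq_sqrt hu.le]; ring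
  have hd : (n : ℝ) ^ 2 + u ≠ 0 := by positivity
  have hd2 : τ ^ 2 + (2 * (π * n)) ^ 2 = 4 * π ^ 2 * ((n : ℝ) ^ 2 + u) := by rw [hsq]; ring
  rw [hd2]
  field_simp
  ring

/-- Nonnegativity of the sine series on half a period passes to `∑ c n / (n * (n ^ 2 + u))`: the
series is odd under `x ↦ 1 - x`, and `exp (-τ x) ≥ exp (-τ (1 - x))` for `x ≤ 1 / 2`. -/
theorem tsum_div_nonneg_of_sineSeries_nonneg {c : ℕ → ℝ} (hc : ∀ n, |c n| ≤ 1)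
    (h : ∀ x ∈ Set.Icc (0 : ℝ) (1 / 2), 0 ≤ sineSeries c x) {u : ℝ} (hu : 0 < u) :
    0 ≤ ∑' n : ℕ, c n / n / ((n : ℝ) ^ 2 + u) := by
  set τ := 2 * π * √u with hτ
  have hτ0 : 0 < τ := by positivity
  have hcont := continuous_sineSeries hc
  have hsplit : ∫ x in (0 : ℝ)..1, sineSeries c x * rexp (-τ * x) =
      ∫ x in (0 : ℝ)..(1 / 2), sineSeries c x * (rexp (-τ * x) - rexp (-τ * (1 - x))) := by
    have hrefl : ∫ x in (1 / 2 : ℝ)..1, sineSeries c x * rexp (-τ * x) =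
        ∫ x in (0 : ℝ)..(1 / 2), -(sineSeries c x * rexp (-τ * (1 - x))) := by
      have := intervalIntegral.integral_comp_sub_left
        (fun x => sineSeries c x * rexp (-τ * x)) (a := 0) (b := 1 / 2) 1
      rw [show (1 : ℝ) - 1 / 2 = 1 / 2 by norm_num, sub_zero] at this
      rw [← this]
      simp only [sineSeries_one_sub, neg_mul]
    rw [← intervalIntegral.integral_add_adjacent_intervals (b := 1 / 2)
      (Continuous.intervalIntegrable (by fun_prop) _ _)
      (Continuous.intervalIntegrable (by fun_prop) _ _), hrefl,
      ← intervalIntegral.integral_add (Continuous.intervalIntegrable (by fun_prop) _ _)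
      (Continuous.intervalIntegrable (by fun_prop) _ _)]
    congr 1
    ext x
    ring
  have hpos : 0 ≤ ∫ x in (0 : ℝ)..1, sineSeries c x * rexp (-τ * x) := by
    rw [hsplit]
    refine intervalIntegral.integral_nonneg (by norm_num) fun x hx =>
      mul_nonneg (h x hx) (sub_nonneg.mpr (Real.exp_le_exp.mpr ?_))
    nlinarith [hx.2]
  rw [hτ, integral_sineSeries_mul_exp hc hu] at hpos
  have hfac : 0 < (1 - rexp (-(2 * π * √u))) / (2 * π) := by
    have : rexp (-(2 * π * √u)) < 1 := by rw [Real.exp_lt_one_iff]; linarith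
    have h2 : 0 < 1 - rexp (-(2 * π * √u)) := by linarith
    positivity
  exact nonneg_of_mul_nonneg_right hpos hfac

end

/-! ### The Mellin transform and the zeros of `ζ` -/

section

open MeasureTheory ProbabilityTheory Complex

/-- The Mellin transform of `1 / (1 + t)` is `Γ(z) Γ(1 - z)`. -/
theorem hasMellin_one_add_inv {z : ℂ} (h0 : 0 < z.re) (h1 : z.re < 1) :
    HasMellin (fun t : ℝ => (((1 + t)⁻¹ : ℝ) : ℂ)) z (Gamma z * Gamma (1 - z)) := by
  have hconv (w : ℂ) (h0 : 0 < w.re) (h1 : w.re < 1) :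
      MellinConvergent (fun t : ℝ => (((1 + t)⁻¹ : ℝ) : ℂ)) w := by
    refine mellinConvergent_of_isBigO_rpow (a := 1) (b := 0) ?_ ?_ h1 ?_ h0
    · refine ContinuousOn.locallyIntegrableOn (fun t ht => ?_) measurableSet_Ioi
      have : (1 + t : ℝ) ≠ 0 := by have := Set.mem_Ioi.mp ht; positivity
      exact (continuous_ofReal.continuousAt.comp
        ((by fun_prop : ContinuousAt (fun t : ℝ => 1 + t) t).inv₀ this)).continuousWithinAt
    · refine Asymptotics.IsBigO.of_bound 1 ?_
      filter_upwards [Filter.eventually_gt_atTop 0] with t ht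
      rw [norm_real, Real.norm_of_nonneg (by positivity), Real.norm_of_nonneg (by positivity),
        Real.rpow_neg_one, one_mul]
      gcongr
      linarith
    · refine Asymptotics.IsBigO.of_bound 1 ?_
      filter_upwards [self_mem_nhdsWithin] with t ht
      have ht' : 0 < t := ht
      rw [norm_real, Real.norm_of_nonneg (by positivity)]
      simpa using inv_le_one_of_one_le₀ (by linarith : 1 ≤ 1 + t)
  refine ⟨hconv z h0 h1, ?_⟩
  -- Write `1 / (1 + t)` as `∫ exp (-v (1 + t)) dv` and exchange the integrals.
  set F : ℝ → ℝ → ℂ := fun t v => (t : ℂ) ^ (z - 1) * cexp (-((1 + t : ℝ) * v)) with hF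
  have hinner (t : ℝ) (ht : 0 < t) :
      ∫ v in Set.Ioi (0 : ℝ), F t v = (t : ℂ) ^ (z - 1) * (((1 + t)⁻¹ : ℝ) : ℂ) := by
    have h := integral_cpow_mul_exp_neg_mul_Ioi (a := 1) (r := 1 + t) (by simp) (by positivity)
    simp only [sub_self, cpow_zero, one_mul, cpow_one, Gamma_one, mul_one] at h
    simp only [hF]
    rw [integral_const_mul, h]
    push_cast
    rw [one_div]
  have hinner' (v : ℝ) (hv : 0 < v) :
      ∫ t in Set.Ioi (0 : ℝ), F t v = Gamma z * ((v : ℂ) ^ ((1 - z) - 1) * cexp (-v)) := by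
    have h := integral_cpow_mul_exp_neg_mul_Ioi h0 hv
    have hv' : (v : ℂ) ≠ 0 := by exact_mod_cast hv.ne'
    have hF' (t : ℝ) : F t v = cexp (-v) * ((t : ℂ) ^ (z - 1) * cexp (-(v * t))) := by
      simp only [hF]
      rw [mul_left_comm, ← Complex.exp_add]
      push_cast
      ring_nf
    simp_rw [hF']
    rw [integral_const_mul, h, one_div, inv_cpow _ _ (by
      rw [arg_ofReal_of_nonneg hv.le]; exact Real.pi_pos.ne), ← cpow_neg,
      show (1 - z) - 1 = -z by ring]
    ring
  have hnorm (t v : ℝ) (ht : 0 < t) :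
      ‖F t v‖ = t ^ (z.re - 1) * Real.exp (-((1 + t) * v)) := by
    simp only [hF]
    rw [norm_mul, norm_cpow_eq_rpow_re_of_pos ht, sub_re, one_re, norm_exp]
    simp
  have hmeas : AEStronglyMeasurable (Function.uncurry F)
      ((volume.restrict (Set.Ioi 0)).prod (volume.restrict (Set.Ioi 0))) := by
    apply Measurable.aestronglyMeasurable
    simp only [hF, Function.uncurry_def]
    fun_prop
  have hint : Integrable (Function.uncurry F)
      ((volume.restrict (Set.Ioi 0)).prod (volume.restrict (Set.Ioi 0))) := by
    rw [integrable_prod_iff hmeas]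
    constructor
    · filter_upwards [ae_restrict_mem measurableSet_Ioi] with t ht
      have ht' : 0 < t := ht
      change Integrable (fun v : ℝ => (t : ℂ) ^ (z - 1) * cexp (-((1 + t : ℝ) * v))) _
      refine Integrable.const_mul ?_ _
      have := (integrableOn_exp_mul_Ioi (a := -(1 + t)) (by linarith) 0).ofReal (𝕜 := ℂ)
      refine this.congr (.of_forall fun v => ?_)
      beta_reduce
      rw [neg_mul]
      exact (ofReal_exp _).trans (by push_cast; rfl)
    · have hre := hconv (z.re : ℂ) (by simpa using h0) (by simpa using h1)
      refine hre.norm.congr ?_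
      filter_upwards [ae_restrict_mem measurableSet_Ioi] with t ht
      have ht' : 0 < t := ht
      have hexp : ∫ v in Set.Ioi (0 : ℝ), Real.exp (-((1 + t) * v)) = (1 + t)⁻¹ := by
        have := integral_exp_mul_Ioi (a := -(1 + t)) (by linarith) 0
        simp only [neg_mul, mul_zero, Real.exp_zero] at this
        rw [this, neg_div_neg_eq, one_div]
      simp only [Function.uncurry, hnorm t _ ht']
      rw [integral_const_mul, hexp, norm_smul, norm_cpow_eq_rpow_re_of_pos ht', norm_real,
        Real.norm_of_nonneg (by positivity)]
      simp
  have hswap := integral_integral_swap hint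
  calc mellin (fun t : ℝ => (((1 + t)⁻¹ : ℝ) : ℂ)) z
      = ∫ t in Set.Ioi (0 : ℝ), ∫ v in Set.Ioi (0 : ℝ), F t v :=
        setIntegral_congr_fun measurableSet_Ioi fun t ht => by
          simp only [hinner t ht, smul_eq_mul]
    _ = ∫ v in Set.Ioi (0 : ℝ), ∫ t in Set.Ioi (0 : ℝ), F t v := hswap
    _ = ∫ v in Set.Ioi (0 : ℝ), Gamma z * ((v : ℂ) ^ ((1 - z) - 1) * cexp (-v)) :=
        setIntegral_congr_fun measurableSet_Ioi fun v hv => hinner' v hv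
    _ = Gamma z * Gamma (1 - z) := by
        rw [integral_const_mul, Gamma_eq_integral (s := 1 - z) (by rw [sub_re, one_re]; linarith),
          GammaIntegral]
        congr 1
        refine setIntegral_congr_fun measurableSet_Ioi fun v hv => ?_
        simp only [mul_comm, ofReal_exp, ofReal_neg]

/-- A series of integrable functions whose `L¹` norms are summable has an integrable sum. -/
theorem integrable_tsum_of_summable_integral_norm {α : Type*} [MeasurableSpace α] {μ : Measure α}
    {F : ℕ → α → ℂ} (hF : ∀ n, Integrable (F n) μ)
    (hm : AEStronglyMeasurable (fun a => ∑' n, F n a) μ)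
    (hs : Summable fun n => ∫ a, ‖F n a‖ ∂μ) : Integrable (fun a => ∑' n, F n a) μ := by
  refine ⟨hm, ?_⟩
  calc ∫⁻ a, ‖∑' n, F n a‖ₑ ∂μ ≤ ∫⁻ a, ∑' n, ‖F n a‖ₑ ∂μ :=
        lintegral_mono fun a => enorm_tsum_le_tsum_enorm
    _ = ∑' n, ∫⁻ a, ‖F n a‖ₑ ∂μ := lintegral_tsum fun n => (hF n).1.enorm
    _ = ∑' n, ENNReal.ofReal (∫ a, ‖F n a‖ ∂μ) :=
        tsum_congr fun n => (ofReal_integral_norm_eq_lintegral_enorm (hF n)).symm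
    _ < ⊤ := hs.tsum_ofReal_lt_top

/-- The function `u ↦ ∑ c n / (n * (n ^ 2 + |u|))`; the absolute value only serves to make it
continuous on the whole line. -/
noncomputable def stieltjesSeries (c : ℕ → ℝ) (u : ℝ) : ℝ :=
  ∑' n : ℕ, c n / n / ((n : ℝ) ^ 2 + |u|)

theorem continuous_stieltjesSeries {c : ℕ → ℝ} (hc : ∀ n, |c n| ≤ 1) :
    Continuous (stieltjesSeries c) := by
  have hs : Summable fun n : ℕ => 1 / (n : ℝ) ^ 3 :=
    Real.summable_one_div_nat_pow.mpr (by norm_num)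
  refine continuous_tsum (fun n => ?_) hs fun n u => ?_
  · rcases eq_or_ne n 0 with rfl | hn
    · simpa using continuous_const
    have hn' : (0 : ℝ) < n := by exact_mod_cast Nat.pos_of_ne_zero hn
    exact continuous_const.div (by fun_prop) fun u => by positivity
  · rcases eq_or_ne n 0 with rfl | hn
    · simp
    have hn' : (0 : ℝ) < n := by exact_mod_cast Nat.pos_of_ne_zero hn
    rw [norm_div, norm_div, Real.norm_of_nonneg hn'.le,
      Real.norm_of_nonneg (by positivity : 0 ≤ (n : ℝ) ^ 2 + |u|), div_div]
    gcongr
    · exact hc n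
    · nlinarith [abs_nonneg u]

/-- The Mellin transform of `∑ c n / (n * (n ^ 2 + u))` is
`Γ(z) Γ(1 - z) ∑ c n * n ^ (-(3 - 2 z))` for `0 < re z < 1`. -/
theorem hasMellin_stieltjesSeries {c : ℕ → ℝ} (hc : ∀ n, |c n| ≤ 1) {z : ℂ} (h0 : 0 < z.re)
    (h1 : z.re < 1) :
    HasMellin (fun u => (stieltjesSeries c u : ℂ)) z
      (Gamma z * Gamma (1 - z) * ∑' n : ℕ, (c n : ℂ) * (n : ℂ) ^ (-(3 - 2 * z))) := by
  set g : ℝ → ℂ := fun t => (((1 + t)⁻¹ : ℝ) : ℂ) with hg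
  have hM := hasMellin_one_add_inv h0 h1
  set F : ℕ → ℝ → ℂ := fun n t =>
    (t : ℂ) ^ (z - 1) • (((c n / n / ((n : ℝ) ^ 2 + |t|) : ℝ)) : ℂ) with hF
  have h3 : (3 - 2 * z) ≠ 0 := fun h => by
    have := congrArg re h
    simp at this
    linarith
  have hscale {n : ℕ} (hn : n ≠ 0) {t : ℝ} (ht : 0 < t) : F n t =
      ((c n / (n : ℝ) ^ 3 : ℝ) : ℂ) * ((t : ℂ) ^ (z - 1) • g (((n : ℝ) ^ 2)⁻¹ * t)) := by
    have hn' : (0 : ℝ) < n := by exact_mod_cast Nat.pos_of_ne_zero hn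
    simp only [hF, hg, abs_of_pos ht, smul_eq_mul]
    rw [mul_left_comm, ← ofReal_mul]
    congr 2
    field_simp
  have hFint (n : ℕ) : IntegrableOn (F n) (Set.Ioi 0) := by
    rcases eq_or_ne n 0 with rfl | hn
    · simp [hF]
    have hn' : (0 : ℝ) < n := by exact_mod_cast Nat.pos_of_ne_zero hn
    have : MellinConvergent (fun t => g (((n : ℝ) ^ 2)⁻¹ * t)) z :=
      (MellinConvergent.comp_mul_left (by positivity)).mpr hM.1
    exact IntegrableOn.congr_fun (Integrable.const_mul this _)
      (fun t ht => (hscale hn ht).symm) measurableSet_Ioi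
  have hFval (n : ℕ) : ∫ t in Set.Ioi (0 : ℝ), F n t =
      Gamma z * Gamma (1 - z) * ((c n : ℂ) * (n : ℂ) ^ (-(3 - 2 * z))) := by
    rcases eq_or_ne n 0 with rfl | hn
    · rw [Nat.cast_zero, zero_cpow (neg_ne_zero.mpr h3)]
      simp [hF]
    have hn' : (0 : ℝ) < n := by exact_mod_cast Nat.pos_of_ne_zero hn
    have hnc : (n : ℂ) ≠ 0 := by exact_mod_cast hn
    rw [setIntegral_congr_fun measurableSet_Ioi (fun t ht => hscale hn ht), integral_const_mul]
    have h := mellin_comp_mul_left g z (a := ((n : ℝ) ^ 2)⁻¹) (by positivity)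
    rw [mellin, hM.2] at h
    rw [h, smul_eq_mul, ofReal_inv, inv_cpow _ _ (by
      rw [arg_ofReal_of_nonneg (by positivity)]; exact Real.pi_pos.ne), cpow_neg, inv_inv,
      show -(3 - 2 * z) = z + z - 3 by ring, cpow_sub _ _ hnc, cpow_add _ _ hnc, ofReal_pow,
      ofReal_natCast, sq, natCast_mul_natCast_cpow]
    push_cast
    rw [show (n : ℂ) ^ (3 : ℂ) = (n : ℂ) ^ 3 by exact_mod_cast cpow_natCast (n : ℂ) 3]
    ring
  have hFnorm (n : ℕ) : ∫ t in Set.Ioi (0 : ℝ), ‖F n t‖ ≤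
      (∫ t in Set.Ioi (0 : ℝ), ‖(t : ℂ) ^ (z - 1) • g t‖) * (n : ℝ) ^ (-(3 - 2 * z.re)) := by
    rcases eq_or_ne n 0 with rfl | hn
    · simp only [hF]
      simp
      positivity
    have hn' : (0 : ℝ) < n := by exact_mod_cast Nat.pos_of_ne_zero hn
    have hpt : ∀ t ∈ Set.Ioi (0 : ℝ), ‖F n t‖ = |c n| * (n : ℝ) ^ (-(3 - 2 * z.re)) *
        ((((n : ℝ) ^ 2)⁻¹) * ‖((((n : ℝ) ^ 2)⁻¹ * t : ℝ) : ℂ) ^ (z - 1) •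
          g (((n : ℝ) ^ 2)⁻¹ * t)‖) := fun t ht => by
      have ht' : 0 < t := ht
      rw [hscale hn ht', norm_mul, norm_smul, norm_smul, norm_cpow_eq_rpow_re_of_pos ht',
        norm_cpow_eq_rpow_re_of_pos (by positivity), norm_real, Real.norm_eq_abs, abs_div,
        abs_of_pos (by positivity : (0 : ℝ) < (n : ℝ) ^ 3), sub_re, one_re,
        Real.mul_rpow (by positivity) ht'.le, Real.inv_rpow (by positivity),
        ← Real.rpow_natCast, ← Real.rpow_natCast, ← Real.rpow_mul hn'.le, ← Real.rpow_neg hn'.le,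
        ← Real.rpow_neg hn'.le, div_eq_mul_inv, ← Real.rpow_neg hn'.le]
      have : (n : ℝ) ^ (-((3 : ℕ) : ℝ)) = (n : ℝ) ^ (-(3 - 2 * z.re)) * ((n : ℝ) ^ (-((2 : ℕ) : ℝ)) *
          (n : ℝ) ^ (-(((2 : ℕ) : ℝ) * (z.re - 1)))) := by
        rw [← Real.rpow_add hn', ← Real.rpow_add hn']
        congr 1
        push_cast
        ring
      rw [this]
      ring
    rw [setIntegral_congr_fun measurableSet_Ioi hpt, integral_const_mul, integral_const_mul,
      integral_comp_mul_left_Ioi (fun t : ℝ => ‖(t : ℂ) ^ (z - 1) • g t‖) 0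
        (by positivity : (0 : ℝ) < ((n : ℝ) ^ 2)⁻¹), mul_zero, smul_eq_mul, ← mul_assoc
        (((n : ℝ) ^ 2)⁻¹), mul_inv_cancel₀ (by positivity), one_mul, mul_comm]
    have hI : 0 ≤ ∫ t in Set.Ioi (0 : ℝ), ‖(t : ℂ) ^ (z - 1) • g t‖ :=
      integral_nonneg fun _ => norm_nonneg _
    refine mul_le_mul_of_nonneg_left ?_ hI
    exact mul_le_of_le_one_left (by positivity) (hc n)
  have hFsum : Summable fun n => ∫ t in Set.Ioi (0 : ℝ), ‖F n t‖ := by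
    refine Summable.of_nonneg_of_le (fun n => integral_nonneg fun _ => norm_nonneg _) hFnorm ?_
    exact (Real.summable_nat_rpow.mpr (by linarith)).mul_left _
  have htsum (t : ℝ) : ∑' n, F n t = (t : ℂ) ^ (z - 1) • (stieltjesSeries c t : ℂ) := by
    simp only [hF, stieltjesSeries, smul_eq_mul]
    rw [ofReal_tsum, tsum_mul_left]
  refine ⟨?_, ?_⟩
  · have hmeas : AEStronglyMeasurable (fun t => ∑' n, F n t) (volume.restrict (Set.Ioi 0)) := by
      simp only [htsum]
      have := (continuous_stieltjesSeries hc).measurable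
      exact Measurable.aestronglyMeasurable (by fun_prop)
    have := integrable_tsum_of_summable_integral_norm hFint hmeas hFsum
    simp only [htsum] at this
    exact this
  · have := (hasSum_integral_of_summable_integral_norm hFint hFsum).tsum_eq
    simp only [htsum, hFval] at this
    rw [mellin, ← this, tsum_mul_left]

/-- For the Liouville coefficients, the Mellin transform of `∑ λ(n) / (n * (n ^ 2 + u))` is
`Γ(z) Γ(1 - z) ζ(6 - 4 z) / ζ(3 - 2 z)`; here the poles at `z = 1` are cleared from both sides. -/
theorem riemannZeta₁_mul_mellin_liouville {z : ℂ} (h0 : 0 < z.re) (h1 : z.re < 1) :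
    riemannZeta₁ (3 - 2 * z) * mellin (fun u => (stieltjesSeries liouvilleHom u : ℂ)) z =
      2 * Gamma z * Gamma (2 - z) * riemannZeta (6 - 4 * z) := by
  have hw : 1 < (3 - 2 * z).re := by simp; linarith
  have hz1 : 1 - z ≠ 0 := fun h => by
    have := congrArg re h
    simp at this
    linarith
  have hw1 : 3 - 2 * z ≠ 1 := fun h => hz1 (by linear_combination h / 2)
  have hζ := tsum_liouvilleHom_mul_riemannZeta hw
  rw [show 2 * (3 - 2 * z) = 6 - 4 * z by ring, riemannZeta_eq_inv_sub_mul hw1,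
    show 3 - 2 * z - 1 = 2 * (1 - z) by ring] at hζ
  rw [(hasMellin_stieltjesSeries abs_liouvilleHom_le_one h0 h1).2, ← hζ,
    show 2 - z = (1 - z) + 1 by ring, Gamma_add_one _ hz1]
  field_simp

/-- If `∑ λ(n) / (n * (n ^ 2 + u))` is nonnegative for all `u > 0`, then `ζ` has no zero with real
part between `1 / 2` and `1`: by Landau's theorem its Mellin transform converges for
`0 < re z < 5 / 4`, whereas a zero `ρ` would make it singular at `z = (3 - ρ) / 2`. -/
theorem riemannZeta_ne_zero_of_stieltjesSeries_nonneg
    (h : ∀ u > 0, 0 ≤ stieltjesSeries liouvilleHom u) {ρ : ℂ} (h1 : 1 / 2 < ρ.re) (h2 : ρ.re < 1) :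
    riemannZeta ρ ≠ 0 := by
  set μ := mellinMeasure (stieltjesSeries liouvilleHom) with hμ
  have hmeas := (continuous_stieltjesSeries abs_liouvilleHom_le_one).measurable
  have hN : DifferentiableOn ℂ (fun z => 2 * Gamma z * Gamma (2 - z) * riemannZeta (6 - 4 * z))
      {z | 0 < z.re ∧ z.re < 5 / 4} := by
    intro z hz
    apply DifferentiableAt.differentiableWithinAt
    have hG {w : ℂ} (hw : 0 < w.re) : DifferentiableAt ℂ Gamma w :=
      differentiableAt_Gamma _ fun m hm => by
        rw [hm] at hw
        simp at hw
        linarith [m.cast_nonneg (α := ℝ)]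
    have hζ : 6 - 4 * z ≠ 1 := fun hh => by
      have := congrArg re hh
      simp at this
      linarith [hz.2]
    refine (((differentiableAt_const _).mul (hG hz.1)).mul ?_).mul ?_
    · exact (hG (w := 2 - z) (by simp; linarith [hz.2])).comp z (by fun_prop)
    · exact (differentiableAt_riemannZeta hζ).comp z (by fun_prop)
  have hL := Ioo_subset_integrableExpSet_of_mul_complexMGF_eq (μ := μ) Real.measurable_log
    (a := 0) (b := 5 / 4) (c := 1) one_pos (by norm_num) hN
    (D := fun z => riemannZeta₁ (3 - 2 * z))
    (differentiable_riemannZeta₁.comp (by fun_prop))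
    (fun t ht => by
      have := riemannZeta₁_ofReal_ne_zero (s := 3 - 2 * t) (by linarith [ht.2]) (by linarith [ht.1])
      push_cast at this
      exact this)
    (fun t ht => mem_integrableExpSet_log_mellinMeasure hmeas h
      (hasMellin_stieltjesSeries abs_liouvilleHom_le_one (by simpa using ht.1)
        (by simpa using ht.2)).1)
    (fun z hz0 hz1 => by
      rw [hμ, complexMGF_log_mellinMeasure hmeas h]
      exact riemannZeta₁_mul_mellin_liouville hz0 hz1)
  intro hρ
  have hz := hL.2 ((3 - ρ) / 2) (by simp; linarith) (by simp; linarith)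
  have hρ1 : ρ ≠ 1 := by rintro rfl; simp at h2
  have hρ0 : riemannZeta₁ ρ = 0 := by
    rw [riemannZeta_eq_inv_sub_mul hρ1] at hρ
    exact (mul_eq_zero.mp hρ).resolve_left (inv_ne_zero (sub_ne_zero.mpr hρ1))
  simp only [show 3 - 2 * ((3 - ρ) / 2) = ρ by ring, hρ0, zero_mul,
    show 6 - 4 * ((3 - ρ) / 2) = 2 * ρ by ring] at hz
  have hne : 2 * Gamma ((3 - ρ) / 2) * Gamma (2 - (3 - ρ) / 2) * riemannZeta (2 * ρ) ≠ 0 := by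
    refine mul_ne_zero (mul_ne_zero (mul_ne_zero two_ne_zero ?_) ?_) ?_
    · exact Gamma_ne_zero_of_re_pos (by simp; linarith)
    · exact Gamma_ne_zero_of_re_pos (by simp; linarith)
    · exact riemannZeta_ne_zero_of_one_le_re (by simp; linarith)
  exact hne hz.symm

/-- By the functional equation, it suffices for the Riemann hypothesis that `ζ` has no zero with
real part between `1 / 2` and `1`. -/
theorem riemannHypothesis_of_ne_zero
    (h : ∀ ρ : ℂ, 1 / 2 < ρ.re → ρ.re < 1 → riemannZeta ρ ≠ 0) : RiemannHypothesis := by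
  intro s hs htriv hs1
  have hlt1 : s.re < 1 := by
    by_contra hge
    exact riemannZeta_ne_zero_of_one_le_re (not_lt.mp hge) hs
  rcases lt_trichotomy s.re (1 / 2) with hlt | heq | hgt
  · exfalso
    have hs0 : s ≠ 0 := by rintro rfl; norm_num [riemannZeta_zero] at hs
    have hcs : Gammaℝ s ≠ 0 := by
      rw [Ne, Gammaℝ_eq_zero_iff]
      rintro ⟨n, hn⟩
      rcases n with _ | n
      · exact hs0 (by simpa using hn)
      · exact htriv ⟨n, by rw [hn]; push_cast; ring⟩
    have hΛ : completedRiemannZeta s = 0 := by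
      rw [riemannZeta_def_of_ne_zero hs0, div_eq_zero_iff] at hs
      exact hs.resolve_right hcs
    have hne0 : 1 - s ≠ 0 := sub_ne_zero.mpr hs1.symm
    have h1s : riemannZeta (1 - s) = 0 := by
      rw [riemannZeta_def_of_ne_zero hne0, completedRiemannZeta_one_sub, hΛ, zero_div]
    rcases lt_or_ge 0 s.re with h0 | h0
    · exact h (1 - s) (by simp; linarith) (by simp; linarith) h1s
    · exact riemannZeta_ne_zero_of_one_le_re (by simp; linarith) h1s
  · exact heq
  · exact absurd hs (h s hgt hlt1)

end

/-! ### Gauss sums and the Legendre test -/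

section
open Real Complex

/-- The quadratic character modulo `q` with complex values. -/
noncomputable def quadraticCharComplex (q : ℕ) [Fact q.Prime] : MulChar (ZMod q) ℂ :=
  (quadraticChar (ZMod q)).ringHomComp (Int.castRingHom ℂ)

theorem quadraticCharComplex_intCast (q : ℕ) [Fact q.Prime] (a : ℤ) :
    quadraticCharComplex q (a : ZMod q) = (legendreSym q a : ℂ) := rfl

theorem quadraticCharComplex_ne_one {q : ℕ} [Fact q.Prime] (hq : q ≠ 2) :
    quadraticCharComplex q ≠ 1 :=
  (MulChar.ringHomComp_ne_one_iff (Int.cast_injective (α := ℂ))).mpr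
    (quadraticChar_ne_one (by rwa [ZMod.ringChar_zmod_n]))

theorem quadraticCharComplex_isQuadratic (q : ℕ) [Fact q.Prime] :
    (quadraticCharComplex q).IsQuadratic :=
  (quadraticChar_isQuadratic (ZMod q)).comp _

/-- The quadratic Gauss sum modulo `q`. -/
noncomputable def quadraticGaussSum (q : ℕ) [Fact q.Prime] : ℂ :=
  gaussSum (quadraticCharComplex q) ZMod.stdAddChar

theorem sum_quadraticCharComplex_mul_stdAddChar {q : ℕ} [Fact q.Prime] (hq : q ≠ 2) (m : ZMod q) :
    ∑ x : ZMod q, quadraticCharComplex q x * ZMod.stdAddChar (m * x) =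
      quadraticCharComplex q m * quadraticGaussSum q := by
  rcases eq_or_ne m 0 with rfl | hm
  · simp only [zero_mul, AddChar.map_zero_eq_one, mul_one, MulChar.map_zero]
    exact MulChar.sum_eq_zero_of_ne_one (quadraticCharComplex_ne_one hq)
  · have h := gaussSum_mulShift (quadraticCharComplex q) ZMod.stdAddChar (Units.mk0 m hm)
    have hsq : quadraticCharComplex q m * quadraticCharComplex q m = 1 := by
      have hu := ((Units.mk0 m hm).isUnit.map (quadraticCharComplex q)).ne_zero
      rcases quadraticCharComplex_isQuadratic q m with h0 | h0 | h0
      · exact absurd h0 hu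
      · rw [h0, one_mul]
      · rw [h0, neg_one_mul, neg_neg]
    rw [quadraticGaussSum, ← h, ← mul_assoc, Units.val_mk0, hsq, one_mul]
    simp [gaussSum, AddChar.mulShift_apply]

/-- For `q ≡ 3 mod 4` the quadratic character is odd, so its Gauss sum is purely imaginary. -/
theorem quadraticGaussSum_re {q : ℕ} [Fact q.Prime] (hq : q % 4 = 3) :
    (quadraticGaussSum q).re = 0 := by
  have hq2 : q ≠ 2 := by rintro rfl; norm_num at hq
  have hinv : (quadraticCharComplex q)⁻¹ = quadraticCharComplex q :=
    (quadraticCharComplex_isQuadratic q).inv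
  have h1 := star_gaussSum_eq (quadraticCharComplex q) ZMod.stdAddChar
  have h2 := mul_gaussSum_inv_eq_gaussSum (quadraticCharComplex q) ZMod.stdAddChar
  have hneg : quadraticCharComplex q (-1) = -1 := by
    have := quadraticCharComplex_intCast q (-1)
    rw [legendreSym.at_neg_one hq2, ZMod.χ₄_nat_three_mod_four hq] at this
    simpa using this
  rw [hneg] at h2
  rw [hinv] at h1
  have h3 : star (quadraticGaussSum q) = -quadraticGaussSum q := by
    rw [quadraticGaussSum, h1, ← h2]
    ring
  have := congrArg re h3
  simp at this
  linarith

/-- By the Chinese remainder theorem, a residue class modulo `p` in `[1, p q]` is a complete system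
of residues modulo `q`. -/
theorem bijOn_residue_class {p q : ℕ} [Fact p.Prime] [Fact q.Prime] (hpq : p ≠ q) (c : ℤ) :
    Set.BijOn (fun b : ℕ => (b : ZMod q))
      ((Finset.Icc 1 (p * q)).filter fun b : ℕ => (b : ℤ) ≡ c [ZMOD (p : ℤ)])
      (Finset.univ : Finset (ZMod q)) := by
  have hp : 0 < p := (Fact.out : p.Prime).pos
  have hq : 0 < q := (Fact.out : q.Prime).pos
  have hcop : Nat.Coprime p q := (Nat.coprime_primes Fact.out Fact.out).mpr hpq
  have hN : 0 < p * q := Nat.mul_pos hp hq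
  refine ⟨fun _ _ => by simp, fun b hb b' hb' h => ?_, fun x _ => ?_⟩
  · simp only [Finset.coe_filter, Finset.mem_Icc, Set.mem_ofPred_eq] at hb hb'
    have h1 : b ≡ b' [MOD p] := (Int.natCast_modEq_iff).mp (hb.2.trans hb'.2.symm)
    have h2 : b ≡ b' [MOD q] := (ZMod.natCast_eq_natCast_iff _ _ _).mp h
    have h3 : b ≡ b' [MOD p * q] := (Nat.modEq_and_modEq_iff_modEq_mul hcop).mp ⟨h1, h2⟩
    have h4 : b - 1 ≡ b' - 1 [MOD p * q] := by
      apply Nat.ModEq.add_right_cancel' 1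
      rwa [Nat.sub_add_cancel hb.1.1, Nat.sub_add_cancel hb'.1.1]
    have h5 := Nat.ModEq.eq_of_lt_of_lt h4 (by omega) (by omega)
    omega
  · obtain ⟨k, hk1, hk2⟩ := Nat.chineseRemainder hcop (c % p).toNat x.val
    have hcp : 0 ≤ c % p := Int.emod_nonneg _ (by exact_mod_cast hp.ne')
    -- The representative of `k` modulo `p q` in `[1, p q]` rather than `[0, p q)`.
    have hb : (k + (p * q - 1)) % (p * q) + 1 ≡ k [MOD p * q] := by
      have := (Nat.mod_modEq (k + (p * q - 1)) (p * q)).add_right 1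
      rw [add_assoc, Nat.sub_add_cancel hN] at this
      exact this.trans (by simp [Nat.ModEq])
    have hlt := Nat.mod_lt (k + (p * q - 1)) hN
    refine ⟨(k + (p * q - 1)) % (p * q) + 1, ?_, ?_⟩
    · simp only [Finset.coe_filter, Finset.mem_Icc, Set.mem_ofPred_eq]
      refine ⟨⟨by omega, by omega⟩, ?_⟩
      have h1 := Int.natCast_modEq_iff.mpr ((hb.of_mul_right q).trans hk1)
      rw [Int.toNat_of_nonneg hcp] at h1
      exact h1.trans (Int.mod_modEq c p)
    · have h2 := (ZMod.natCast_eq_natCast_iff _ _ _).mpr ((hb.of_mul_left p).trans hk2)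
      simpa using h2

/-- The finite Fourier transform of `χ_q` along the residue class of `c q` modulo `p`: writing
`b = c q + p y` separates the exponential into a factor modulo `p` and an additive character
modulo `q`. -/
theorem sum_legendreSym_mul_exp {p q : ℕ} [Fact p.Prime] [Fact q.Prime] (hpq : p ≠ q)
    (hq2 : q ≠ 2) (n : ℕ) (c : ℤ) :
    ∑ b ∈ (Finset.Icc 1 (p * q)).filter (fun b : ℕ => (b : ℤ) ≡ c * q [ZMOD (p : ℤ)]),
        (legendreSym q b : ℂ) * cexp (2 * π * I * (n * b / (p * q))) =
      legendreSym q p * legendreSym q n * quadraticGaussSum q * cexp (2 * π * I * (n * c / p)) := by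
  have hp0 : (p : ℂ) ≠ 0 := by exact_mod_cast (Fact.out : p.Prime).ne_zero
  have hq0 : (q : ℂ) ≠ 0 := by exact_mod_cast (Fact.out : q.Prime).ne_zero
  have hpz : (p : ZMod q) ≠ 0 := ZMod.prime_ne_zero q p hpq.symm
  have hterm : ∀ b ∈ (Finset.Icc 1 (p * q)).filter
      (fun b : ℕ => (b : ℤ) ≡ c * q [ZMOD (p : ℤ)]),
      (legendreSym q b : ℂ) * cexp (2 * π * I * (n * b / (p * q))) =
        cexp (2 * π * I * (n * c / p)) * (quadraticCharComplex q (b : ZMod q) *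
          ZMod.stdAddChar ((n : ZMod q) * (p : ZMod q)⁻¹ * (b : ZMod q))) := by
    intro b hb
    obtain ⟨y, hy⟩ := (Int.modEq_iff_dvd.mp (Finset.mem_filter.mp hb).2.symm)
    have hby : (b : ℤ) = c * q + p * y := by linarith
    have hbz : (b : ZMod q) = p * (y : ZMod q) := by
      have := congrArg (Int.cast : ℤ → ZMod q) hby
      push_cast at this
      rw [this]
      simp
    have hbc : (b : ℂ) = c * q + p * y := by exact_mod_cast hby
    have harg : (n : ZMod q) * (p : ZMod q)⁻¹ * (b : ZMod q) = ((n * y : ℤ) : ZMod q) := by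
      rw [hbz]
      push_cast
      field_simp
    have hchar : quadraticCharComplex q (b : ZMod q) = (legendreSym q b : ℂ) := by
      rw [← quadraticCharComplex_intCast]
      simp
    rw [harg, ZMod.stdAddChar_coe, hchar, mul_left_comm, ← Complex.exp_add, hbc]
    congr 2
    push_cast
    field_simp
  rw [Finset.sum_congr rfl hterm, ← Finset.mul_sum]
  have hbij := bijOn_residue_class hpq (c * q)
  rw [Finset.sum_nbij (t := Finset.univ) (fun b : ℕ => (b : ZMod q))
      (fun b hb => Finset.mem_univ _) hbij.injOn hbij.surjOn (fun b _ => rfl)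
      (g := fun x => quadraticCharComplex q x *
        ZMod.stdAddChar ((n : ZMod q) * (p : ZMod q)⁻¹ * x)),
    sum_quadraticCharComplex_mul_stdAddChar hq2, map_mul]
  have hinv : quadraticCharComplex q (p : ZMod q)⁻¹ = (legendreSym q p : ℂ) := by
    rw [← MulChar.inv_apply', (quadraticCharComplex_isQuadratic q).inv,
      ← quadraticCharComplex_intCast]
    simp
  have hn : quadraticCharComplex q (n : ZMod q) = (legendreSym q n : ℂ) := by
    rw [← quadraticCharComplex_intCast]
    simp
  rw [hinv, hn]
  ring

/-- Real part of the finite Fourier transform of `χ_q` along a residue class modulo `p`. -/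
theorem sum_legendreSym_mul_cos {p q : ℕ} [Fact p.Prime] [Fact q.Prime] (hpq : p ≠ q)
    (hq : q % 4 = 3) (n : ℕ) (c : ℤ) :
    ∑ b ∈ (Finset.Icc 1 (p * q)).filter (fun b : ℕ => (b : ℤ) ≡ c * q [ZMOD (p : ℤ)]),
        (legendreSym q b : ℝ) * Real.cos (2 * π * n * (b / (p * q : ℝ))) =
      -(legendreSym q p * legendreSym q n * (quadraticGaussSum q).im *
        Real.sin (2 * π * n * (c / p : ℝ))) := by
  have hq2 : q ≠ 2 := by rintro rfl; norm_num at hq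
  have h := congrArg re (sum_legendreSym_mul_exp hpq hq2 n c)
  rw [re_sum] at h
  have hexp (x : ℝ) : cexp (2 * π * I * x) =
      (Real.cos (2 * π * x) : ℝ) + (Real.sin (2 * π * x) : ℝ) * I := by
    rw [ofReal_cos, ofReal_sin, ← exp_mul_I]
    push_cast
    ring_nf
  have hg : quadraticGaussSum q = (quadraticGaussSum q).im * I := by
    apply Complex.ext <;> simp [quadraticGaussSum_re hq]
  have hcos (r x : ℝ) : ((r : ℂ) * cexp (2 * π * I * x)).re = r * Real.cos (2 * π * x) := by
    rw [hexp, re_ofReal_mul, add_re, ofReal_re, re_ofReal_mul, I_re, mul_zero, add_zero]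
  have hsin (r t x : ℝ) : ((r : ℂ) * (t * I) * cexp (2 * π * I * x)).re =
      -(r * t * Real.sin (2 * π * x)) := by
    rw [hexp]
    generalize Real.cos (2 * π * x) = C, Real.sin (2 * π * x) = S
    have : (r : ℂ) * (t * I) * (C + S * I) = (-(r * t * S) : ℝ) + (r * t * C : ℝ) * I := by
      push_cast
      linear_combination (r : ℂ) * t * S * I_sq
    rw [this, add_re, ofReal_re, re_ofReal_mul, I_re, mul_zero, add_zero]
  have hl (b : ℕ) : ((legendreSym q b : ℂ) * cexp (2 * π * I * (n * b / (p * q)))).re =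
      (legendreSym q b : ℝ) * Real.cos (2 * π * n * (b / (p * q : ℝ))) := by
    have := hcos (legendreSym q b) (n * b / (p * q))
    push_cast at this
    rw [this]
    ring_nf
  simp only [hl] at h
  have := hsin (legendreSym q p * legendreSym q n) (quadraticGaussSum q).im (n * c / p)
  push_cast at this
  rw [← hg] at this
  rw [h, this]
  ring_nf

/-- This is the case `n = 0` of the preceding formula, where `χ_q(0) = 0`. -/
theorem sum_legendreSym_residue_class {p q : ℕ} [Fact p.Prime] [Fact q.Prime] (hpq : p ≠ q)
    (hq : q % 4 = 3) (c : ℤ) :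
    ∑ b ∈ (Finset.Icc 1 (p * q)).filter (fun b : ℕ => (b : ℤ) ≡ c * q [ZMOD (p : ℤ)]),
        (legendreSym q b : ℝ) = 0 := by
  simpa using sum_legendreSym_mul_cos hpq hq 0 c

/-- The reflection `b ↦ p q - b` exchanges the residue classes `a q` and `-a q`, and changes the
sign of the odd character `χ_q`. -/
theorem sum_mul_legendreSym_eq_neg_class {p q : ℕ} [Fact p.Prime] [Fact q.Prime] (hpq : p ≠ q)
    (hq : q % 4 = 3) {a : ℤ} (ha : ¬ (p : ℤ) ∣ a) :
    ∑ b ∈ (Finset.Icc 1 (p * q)).filter (fun b : ℕ => (b : ℤ) ≡ a * q [ZMOD (p : ℤ)]),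
        (b : ℝ) * legendreSym q b =
      ∑ b ∈ (Finset.Icc 1 (p * q)).filter (fun b : ℕ => (b : ℤ) ≡ -a * q [ZMOD (p : ℤ)]),
        (b : ℝ) * legendreSym q b := by
  have hq2 : q ≠ 2 := by rintro rfl; norm_num at hq
  have hpP : Prime (p : ℤ) := Nat.prime_iff_prime_int.mp Fact.out
  have hpq' : ¬ (p : ℤ) ∣ q := fun h => hpq
    ((Nat.prime_dvd_prime_iff_eq Fact.out Fact.out).mp (Int.natCast_dvd_natCast.mp h))
  have hmem (a : ℤ) (ha : ¬ (p : ℤ) ∣ a) (b : ℕ)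
      (hb : b ∈ (Finset.Icc 1 (p * q)).filter (fun b : ℕ => (b : ℤ) ≡ a * q [ZMOD (p : ℤ)])) :
      b < p * q ∧ p * q - b ∈ (Finset.Icc 1 (p * q)).filter
        (fun b : ℕ => (b : ℤ) ≡ -a * q [ZMOD (p : ℤ)]) := by
    rw [Finset.mem_filter, Finset.mem_Icc] at hb
    have hne : b ≠ p * q := by
      rintro rfl
      have h0 := hb.2.symm.dvd
      push_cast at h0
      rw [dvd_sub_right (dvd_mul_right _ _)] at h0
      exact (hpP.dvd_or_dvd h0).elim ha hpq'
    refine ⟨by omega, ?_⟩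
    rw [Finset.mem_filter, Finset.mem_Icc]
    refine ⟨by omega, ?_⟩
    rw [Nat.cast_sub hb.1.2, Int.modEq_iff_dvd]
    have h0 := hb.2.symm.dvd
    push_cast
    have : -a * q - (p * q - b : ℤ) = (b - a * q) - p * q := by ring
    rw [this]
    exact dvd_sub h0 (dvd_mul_right _ _)
  have hodd (b : ℕ) (hb : b ≤ p * q) :
      (legendreSym q ((p * q - b : ℕ) : ℤ) : ℝ) = -legendreSym q b := by
    have h1 : legendreSym q ((p * q - b : ℕ) : ℤ) = legendreSym q (-1 * b) := by
      rw [Nat.cast_sub hb]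
      simp [legendreSym]
    rw [h1, legendreSym.mul, legendreSym.at_neg_one hq2, ZMod.χ₄_nat_three_mod_four hq]
    simp
  have ha' : ¬ (p : ℤ) ∣ -a := by rwa [dvd_neg]
  have hrefl : ∑ b ∈ (Finset.Icc 1 (p * q)).filter (fun b : ℕ => (b : ℤ) ≡ a * q [ZMOD (p : ℤ)]),
        (b : ℝ) * legendreSym q b =
      ∑ b ∈ (Finset.Icc 1 (p * q)).filter (fun b : ℕ => (b : ℤ) ≡ -a * q [ZMOD (p : ℤ)]),
        ((b : ℝ) * legendreSym q b - p * q * legendreSym q b) := by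
    refine Finset.sum_nbij' (p * q - ·) (p * q - ·) (fun b hb => (hmem a ha b hb).2)
      (fun b hb => by simpa using (hmem (-a) ha' b hb).2)
      (fun b hb => Nat.sub_sub_self (hmem a ha b hb).1.le)
      (fun b hb => Nat.sub_sub_self (hmem (-a) ha' b hb).1.le) fun b hb => ?_
    have hle := (hmem a ha b hb).1.le
    rw [hodd b hle, Nat.cast_sub hle]
    push_cast
    ring
  rw [hrefl, Finset.sum_sub_distrib, ← Finset.mul_sum, sum_legendreSym_residue_class hpq hq,
    mul_zero, sub_zero]

theorem hasSum_cos_div_sq {x : ℝ} (hx : x ∈ Set.Icc (0 : ℝ) 1) :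
    HasSum (fun n : ℕ => 1 / (n : ℝ) ^ 2 * Real.cos (2 * π * n * x))
      (π ^ 2 * (x ^ 2 - x + 1 / 6)) := by
  have h := hasSum_one_div_nat_pow_mul_cos one_ne_zero hx
  simp only [mul_one] at h
  convert h using 1
  have hB : Polynomial.bernoulli 2 =
      Polynomial.X ^ 2 - Polynomial.X + Polynomial.C (1 / 6 : ℚ) := by
    rw [Polynomial.bernoulli]
    simp [Finset.sum_range_succ, ← Polynomial.C_mul_X_pow_eq_monomial, sub_eq_add_neg]
    rw [show (2 : Polynomial ℚ) = Polynomial.C 2 from (map_ofNat _ 2).symm, ← Polynomial.C_mul]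
    norm_num
  have heval : Polynomial.eval x (Polynomial.map (algebraMap ℚ ℝ) (Polynomial.bernoulli 2)) =
      x ^ 2 - x + 1 / 6 := by
    rw [hB]
    simp
  rw [heval, Nat.factorial_two]
  push_cast
  ring

/-- The Fourier expansion of the second Bernoulli polynomial turns `legendreTest` into a sine
series with coefficients `χ_q(n) / n ^ 2`, up to a positive factor and the imaginary part of the
Gauss sum of `χ_q`. -/
theorem legendreTest_eq {p q : ℕ} [Fact p.Prime] [Fact q.Prime] (hpq : p ≠ q)
    (hq : q % 4 = 3) {a : ℕ} (ha0 : 0 < a) (hap : a < p) :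
    (legendreTest a p q : ℝ) = 2 * (p * q) ^ 2 / π ^ 2 * (quadraticGaussSum q).im *
      sineSeries (fun n => legendreSym q n) (a / p) := by
  have hp0 : (0 : ℝ) < p := by exact_mod_cast (Fact.out : p.Prime).pos
  have hq0 : (0 : ℝ) < q := by exact_mod_cast (Fact.out : q.Prime).pos
  have hpa : ¬ (p : ℤ) ∣ a := fun h =>
    absurd (Nat.le_of_dvd ha0 (Int.natCast_dvd_natCast.mp h)) (by omega)
  have hsum (c : ℤ) : HasSum (fun n : ℕ => 1 / (n : ℝ) ^ 2 * -(legendreSym q p * legendreSym q n *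
      (quadraticGaussSum q).im * Real.sin (2 * π * n * (c / p : ℝ))))
      (∑ b ∈ (Finset.Icc 1 (p * q)).filter (fun b : ℕ => (b : ℤ) ≡ c * q [ZMOD (p : ℤ)]),
        (legendreSym q b : ℝ) * (π ^ 2 * ((b / (p * q : ℝ)) ^ 2 - b / (p * q : ℝ) + 1 / 6))) := by
    have h := hasSum_sum (f := fun (b n : ℕ) => (legendreSym q b : ℝ) *
        (1 / (n : ℝ) ^ 2 * Real.cos (2 * π * n * (b / (p * q : ℝ)))))
      (s := (Finset.Icc 1 (p * q)).filter (fun b : ℕ => (b : ℤ) ≡ c * q [ZMOD (p : ℤ)]))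
      (fun b hb => (hasSum_cos_div_sq (x := b / (p * q : ℝ)) ⟨by positivity, by
        rw [div_le_one (by positivity)]
        exact_mod_cast (Finset.mem_Icc.mp (Finset.mem_filter.mp hb).1).2⟩).mul_left
          (legendreSym q b : ℝ))
    refine h.congr_fun fun n => ?_
    rw [← sum_legendreSym_mul_cos hpq hq n c, Finset.mul_sum]
    exact Finset.sum_congr rfl fun b _ => by ring
  have hexpand (c : ℤ) : ∑ b ∈ (Finset.Icc 1 (p * q)).filter
        (fun b : ℕ => (b : ℤ) ≡ c * q [ZMOD (p : ℤ)]),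
        (legendreSym q b : ℝ) * (π ^ 2 * ((b / (p * q : ℝ)) ^ 2 - b / (p * q : ℝ) + 1 / 6)) =
      π ^ 2 / (p * q) ^ 2 * ∑ b ∈ (Finset.Icc 1 (p * q)).filter
        (fun b : ℕ => (b : ℤ) ≡ c * q [ZMOD (p : ℤ)]), (b : ℝ) ^ 2 * legendreSym q b -
      π ^ 2 / (p * q) * ∑ b ∈ (Finset.Icc 1 (p * q)).filter
        (fun b : ℕ => (b : ℤ) ≡ c * q [ZMOD (p : ℤ)]), (b : ℝ) * legendreSym q b := by
    rw [← add_zero (_ - _), ← mul_zero (π ^ 2 / 6), ← sum_legendreSym_residue_class hpq hq c,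
      Finset.mul_sum, Finset.mul_sum, Finset.mul_sum, ← Finset.sum_sub_distrib,
      ← Finset.sum_add_distrib]
    refine Finset.sum_congr rfl fun b _ => ?_
    field_simp
  have hdiff := ((hsum a).sub (hsum (-a))).tsum_eq
  rw [hexpand, hexpand, sum_mul_legendreSym_eq_neg_class hpq hq hpa] at hdiff
  have hterm : ∑' n : ℕ, (1 / (n : ℝ) ^ 2 * -(legendreSym q p * legendreSym q n *
      (quadraticGaussSum q).im * Real.sin (2 * π * n * (((a : ℤ) : ℝ) / p))) -
      1 / (n : ℝ) ^ 2 * -(legendreSym q p * legendreSym q n *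
      (quadraticGaussSum q).im * Real.sin (2 * π * n * (((-a : ℤ) : ℝ) / p)))) =
      -(2 * legendreSym q p * (quadraticGaussSum q).im) *
        sineSeries (fun n => legendreSym q n) (a / p) := by
    rw [sineSeries, ← tsum_mul_left]
    refine tsum_congr fun n => ?_
    have hsin : Real.sin (2 * π * n * (((-a : ℤ) : ℝ) / p)) =
        -Real.sin (2 * π * n * (a / p)) := by
      rw [← Real.sin_neg]
      push_cast
      ring_nf
    rw [hsin]
    push_cast
    ring
  rw [hterm] at hdiff
  have hχ : (legendreSym q p : ℝ) ^ 2 = 1 := by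
    exact_mod_cast legendreSym.sq_one q (a := p) (by
      simpa using ZMod.prime_ne_zero q p hpq.symm)
  rw [legendreTest]
  push_cast
  simp only [neg_mul (a : ℤ)] at hdiff
  have hkey := congrArg (fun x => -(legendreSym q p : ℝ) * ((p * q : ℝ) ^ 2 / π ^ 2) * x) hdiff
  have hπ := Real.pi_ne_zero
  have hL : -(legendreSym q p : ℝ) * ((p * q : ℝ) ^ 2 / π ^ 2) *
      (-(2 * legendreSym q p * (quadraticGaussSum q).im) *
        sineSeries (fun n => legendreSym q n) (a / p)) =
      2 * (p * q) ^ 2 / π ^ 2 * (quadraticGaussSum q).im *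
      sineSeries (fun n => legendreSym q n) (a / p) := by
    linear_combination 2 * (p * q : ℝ) ^ 2 / π ^ 2 * (quadraticGaussSum q).im *
      sineSeries (fun n => legendreSym q n) (a / p) * hχ
  rw [← hL, hkey]
  field_simp
  ring
end

/-! ### Approximating the Liouville function by quadratic characters -/

/-- Quadratic reciprocity for a fixed odd prime `l`: some residue class modulo `l` forces
`χ_q(l) = -1` for all primes `q ≡ 3 mod 4` in it. -/
theorem exists_residue_legendreSym_eq_neg_one {l : ℕ} [Fact l.Prime] (hl : l ≠ 2) :
    ∃ r : ℕ, r.Coprime l ∧ ∀ (q : ℕ) [Fact q.Prime], q % 4 = 3 → q ≡ r [MOD l] →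
      legendreSym q l = -1 := by
  have hlP : l.Prime := Fact.out
  have hodd := hlP.mod_two_eq_one_iff_ne_two.mpr hl
  have h4 : l % 4 = 1 ∨ l % 4 = 3 := by omega
  rcases h4 with h4 | h4
  · obtain ⟨x, hx⟩ := quadraticChar_exists_neg_one' (F := ZMod l) (by rwa [ZMod.ringChar_zmod_n])
    have hcast : ((x : ZMod l).val : ZMod l) = x := ZMod.natCast_zmod_val _
    refine ⟨(x : ZMod l).val, ZMod.val_coe_unit_coprime x, fun q _ hq hqr => ?_⟩
    have hq2 : q ≠ 2 := by rintro rfl; norm_num at hq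
    rw [legendreSym.quadratic_reciprocity_one_mod_four h4 hq2]
    have := (ZMod.natCast_eq_natCast_iff _ _ _).mpr hqr
    rw [hcast] at this
    rw [legendreSym, Int.cast_natCast, this, hx]
  · refine ⟨1, Nat.coprime_one_left l, fun q _ hq hqr => ?_⟩
    rw [legendreSym.quadratic_reciprocity_three_mod_four h4 hq]
    have := (ZMod.natCast_eq_natCast_iff _ _ _).mpr hqr
    rw [legendreSym, Int.cast_natCast, this]
    simp

/-- By Dirichlet's theorem there are arbitrarily large primes `q ≡ 3 mod 8` modulo which every
prime `l ≤ N` is a quadratic nonresidue. -/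
theorem exists_prime_legendreSym_eq_neg_one (N : ℕ) :
    ∃ q : ℕ, ∃ _ : Fact q.Prime, N < q ∧ q % 8 = 3 ∧
      ∀ l : ℕ, l.Prime → l ≤ N → legendreSym q l = -1 := by
  classical
  have hr (l : ℕ) : ∃ r : ℕ, l.Prime → l ≠ 2 → r.Coprime l ∧
      ∀ (q : ℕ) [Fact q.Prime], q % 4 = 3 → q ≡ r [MOD l] → legendreSym q l = -1 := by
    by_cases hl : l.Prime ∧ l ≠ 2
    · have : Fact l.Prime := ⟨hl.1⟩
      obtain ⟨r, hr⟩ := exists_residue_legendreSym_eq_neg_one hl.2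
      exact ⟨r, fun _ _ => hr⟩
    · exact ⟨0, fun h1 h2 => absurd ⟨h1, h2⟩ hl⟩
  choose r hr using hr
  -- The prime `2` enters with the modulus `8` and is included for every `N`.
  set T : Finset ℕ := (Finset.range (N + 3)).filter Nat.Prime with hT
  set m : ℕ → ℕ := fun l => if l = 2 then 8 else l with hm
  set a : ℕ → ℕ := fun l => if l = 2 then 3 else r l with ha
  have hm0 : ∀ l ∈ T, m l ≠ 0 := fun l hl => by
    simp only [hm]
    split_ifs
    · norm_num
    · exact (Finset.mem_filter.mp hl).2.ne_zero
  have hcop2 {l : ℕ} (hl : l.Prime) (h2 : l ≠ 2) : Nat.Coprime 8 l :=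
    Nat.Coprime.pow_left 3 ((Nat.coprime_primes Nat.prime_two hl).mpr h2.symm)
  have hmcop : Set.Pairwise (T : Set ℕ) (Function.onFun Nat.Coprime m) := by
    intro l hl l' hl' hne
    have hlP := (Finset.mem_filter.mp hl).2
    have hlP' := (Finset.mem_filter.mp hl').2
    simp only [Function.onFun, hm]
    split_ifs with h1 h2 h2
    · exact absurd (h1.trans h2.symm) hne
    · exact hcop2 hlP' h2
    · exact (hcop2 hlP h1).symm
    · exact (Nat.coprime_primes hlP hlP').mpr hne
  obtain ⟨k, hk⟩ := Nat.chineseRemainderOfFinset a m T hm0 hmcop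
  have hacop : ∀ l ∈ T, (a l).Coprime (m l) := fun l hl => by
    simp only [ha, hm]
    split_ifs with h
    · norm_num
    · exact (hr l (Finset.mem_filter.mp hl).2 h).1
  have hkcop : k.Coprime (∏ l ∈ T, m l) := Nat.Coprime.prod_right fun l hl => by
    rw [Nat.Coprime, (hk l hl).gcd_eq]
    exact hacop l hl
  obtain ⟨q, hqN, hqP, hqk⟩ := Nat.forall_exists_prime_gt_and_modEq N
    (Finset.prod_ne_zero_iff.mpr hm0) hkcop
  have hqa : ∀ l ∈ T, q ≡ a l [MOD m l] := fun l hl =>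
    (hqk.of_dvd (Finset.dvd_prod_of_mem m hl)).trans (hk l hl)
  have hq8 : q % 8 = 3 := by
    have h2 := hqa 2 (Finset.mem_filter.mpr ⟨by simp, Nat.prime_two⟩)
    simpa [ha, hm, Nat.ModEq] using h2
  have : Fact q.Prime := ⟨hqP⟩
  refine ⟨q, ⟨hqP⟩, hqN, hq8, fun l hl hlN => ?_⟩
  rcases eq_or_ne l 2 with rfl | h2
  · have hq2 : q ≠ 2 := by rintro rfl; norm_num at hq8
    have := legendreSym.at_two hq2
    rw [ZMod.χ₈_nat_eq_if_mod_eight] at this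
    simpa [hq8, show q % 2 = 1 by omega] using this
  · have h := hqa l (Finset.mem_filter.mpr ⟨by simp; omega, hl⟩)
    simp only [ha, hm, if_neg h2] at h
    exact (hr l hl h2).2 q (by omega) h

theorem legendreSym_eq_liouvilleHom {q N : ℕ} [Fact q.Prime]
    (h : ∀ l : ℕ, l.Prime → l ≤ N → legendreSym q l = -1) (n : ℕ) (hn : n ≤ N) :
    (legendreSym q n : ℝ) = liouvilleHom n := by
  induction n using Nat.recOnMul with
  | zero => simp
  | one => simp
  | prime p hp => rw [h p hp hn, liouvilleHom_apply_prime hp]; simp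
  | mul a b iha ihb =>
    rcases Nat.eq_zero_or_pos a with rfl | ha
    · simp
    rcases Nat.eq_zero_or_pos b with rfl | hb
    · simp
    rw [Nat.cast_mul, legendreSym.mul, Int.cast_mul, map_mul,
      iha ((Nat.le_mul_of_pos_right a hb).trans hn), ihb ((Nat.le_mul_of_pos_left b ha).trans hn)]

theorem abs_legendreSym_le_one (q : ℕ) [Fact q.Prime] (a : ℤ) : |(legendreSym q a : ℝ)| ≤ 1 := by
  rcases quadraticChar_isQuadratic (ZMod q) (a : ZMod q) with h | h | h <;>
    simp [legendreSym, h]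

open Real in
/-- At `x = 1 / 3` the term `n = 1` dominates: `√3 / 2 > ∑ 1 / n ^ 2` over `n ≥ 2`. -/
theorem sineSeries_one_third_pos {c : ℕ → ℝ} (hc : ∀ n, |c n| ≤ 1) (hc1 : c 1 = 1) :
    0 < sineSeries c (1 / 3) := by
  have h := (summable_sineSeries hc (1 / 3)).hasSum.add hasSum_zeta_two
  -- Adding `∑ 1 / n ^ 2 = π ^ 2 / 6` makes every term nonnegative.
  have hle := le_hasSum h 1 fun n _ => by
    have := (abs_le.mp (norm_sineSeries_term_le hc n (1 / 3))).1
    linarith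
  have hsin : Real.sin (2 * π * (1 : ℕ) * (1 / 3)) = √3 / 2 := by
    rw [show 2 * π * (1 : ℕ) * (1 / 3) = π - π / 3 by push_cast; ring, Real.sin_pi_sub,
      Real.sin_pi_div_three]
  rw [hsin, hc1] at hle
  change _ ≤ sineSeries c (1 / 3) + π ^ 2 / 6 at hle
  have h3 : (1.7 : ℝ) ≤ √3 := Real.le_sqrt_of_sq_le (by norm_num)
  have hπ := Real.pi_lt_d2
  have hπ0 := Real.pi_pos
  have hπ2 : π ^ 2 < 3.15 ^ 2 := by gcongr
  norm_num at hle hπ2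
  linarith

open Filter Topology in
/-- Approximating the Liouville function by the characters `χ_q` on longer and longer initial
segments, nonnegativity at the fractions `a / p` passes to the Liouville sine series. -/
theorem sineSeries_liouville_nonneg
    (h : ∀ (p q : ℕ) [Fact p.Prime] [Fact q.Prime], p % 8 = 3 → q % 8 = 3 → p < q →
      ∀ a : ℕ, 0 < a → (a : ℝ) < (p : ℝ) / 2 →
        0 ≤ sineSeries (fun n => legendreSym q n) (a / p)) :
    ∀ x ∈ Set.Icc (0 : ℝ) (1 / 2), 0 ≤ sineSeries liouvilleHom x := by
  have hfrac (p : ℕ) [Fact p.Prime] (hp : p % 8 = 3) (a : ℕ) (ha : 0 < a)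
      (hap : (a : ℝ) < (p : ℝ) / 2) : 0 ≤ sineSeries liouvilleHom (a / p) := by
    choose q hqP hqN hq8 hq using exists_prime_legendreSym_eq_neg_one
    have hlim : Tendsto (fun N => sineSeries (fun n => legendreSym (q N) n) (a / p)) atTop
        (𝓝 (sineSeries liouvilleHom (a / p))) := by
      refine tendsto_tsum_of_dominated_convergence summable_one_div_nat_sq (fun n => ?_)
        (.of_forall fun N n => norm_sineSeries_term_le
          (fun n => abs_legendreSym_le_one (q N) n) n _)
      refine tendsto_const_nhds.congr' ?_
      filter_upwards [eventually_ge_atTop n] with N hN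
      rw [legendreSym_eq_liouvilleHom (hq N) n hN]
    refine ge_of_tendsto hlim ?_
    filter_upwards [eventually_ge_atTop p] with N hN
    exact h p (q N) hp (hq8 N) (hN.trans_lt (hqN N)) a ha hap
  have hcont := continuous_sineSeries abs_liouvilleHom_le_one
  have hclosed : IsClosed {x | 0 ≤ sineSeries liouvilleHom x} := isClosed_le continuous_const hcont
  suffices hIoo : Set.Ioo (0 : ℝ) (1 / 2) ⊆ {x | 0 ≤ sineSeries liouvilleHom x} by
    have := closure_minimal hIoo hclosed
    rwa [closure_Ioo (by norm_num)] at this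
  intro x hx
  -- Approximate `x` by the fractions `⌊x p⌋ / p` with `p ≡ 3 mod 8`.
  choose p hpN hpP hp8 using fun N : ℕ =>
    Nat.forall_exists_prime_gt_and_modEq N (q := 8) (a := 3) (by norm_num) (by norm_num)
  have hptop : Tendsto (fun N => (p N : ℝ)) atTop atTop :=
    tendsto_natCast_atTop_atTop.comp (tendsto_atTop_mono (fun N => (hpN N).le) tendsto_id)
  have hfloor : Tendsto (fun N => ((⌊x * p N⌋₊ : ℕ) : ℝ) / p N) atTop (𝓝 x) :=
    (tendsto_nat_floor_mul_div_atTop hx.1.le).comp hptop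
  refine ge_of_tendsto ((hcont.tendsto x).comp hfloor) ?_
  filter_upwards [(hptop.const_mul_atTop hx.1).eventually_ge_atTop 1] with N hN
  have : Fact (p N).Prime := ⟨hpP N⟩
  have hp0 : (0 : ℝ) < p N := by exact_mod_cast (hpP N).pos
  refine hfrac (p N) (hp8 N) _ (Nat.floor_pos.mpr hN) ?_
  have := Nat.floor_le (mul_pos hx.1 hp0).le
  nlinarith [hx.2]

/-! ### The Riemann hypothesis -/

theorem mainTheorem8
    (h : ∀ (p q : ℕ) [Fact p.Prime] [Fact q.Prime],
      p % 8 = 3 → q % 8 = 3 → p < q →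
        ∀ a : ℕ, 0 < a → (a : ℝ) < (p : ℝ) / 2 → 0 < legendreTest a p q) :
    RiemannHypothesis := by
  have hpos (p q : ℕ) [Fact p.Prime] [Fact q.Prime] (hp : p % 8 = 3) (hq : q % 8 = 3) (hpq : p < q)
      (a : ℕ) (ha : 0 < a) (hap : (a : ℝ) < (p : ℝ) / 2) :
      0 < (quadraticGaussSum q).im * sineSeries (fun n => legendreSym q n) (a / p) := by
    have hap' : a < p := by
      have : (0 : ℝ) < p := by exact_mod_cast (Fact.out : p.Prime).pos
      exact_mod_cast (by linarith : (a : ℝ) < p)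
    have h1 : (0 : ℝ) < legendreTest a p q := by exact_mod_cast h p q hp hq hpq a ha hap
    rw [legendreTest_eq hpq.ne (by omega) ha hap', mul_assoc] at h1
    exact pos_of_mul_pos_right h1 (by positivity)
  -- The instance `p = 3`, `a = 1` of the hypothesis determines the sign of the Gauss sum.
  have hgauss (q : ℕ) [Fact q.Prime] (hq : q % 8 = 3) (hq3 : 3 < q) :
      0 < (quadraticGaussSum q).im := by
    have : Fact (Nat.Prime 3) := ⟨Nat.prime_three⟩
    have h1 := hpos 3 q (by norm_num) hq hq3 1 one_pos (by norm_num)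
    have h2 := sineSeries_one_third_pos (fun n => abs_legendreSym_le_one q n) (by simp)
    refine pos_of_mul_pos_left h1 ?_
    simpa using h2.le
  have hsine := sineSeries_liouville_nonneg fun p q _ _ hp hq hpq a ha hap =>
    (pos_of_mul_pos_right (hpos p q hp hq hpq a ha hap) (hgauss q hq (by omega)).le).le
  refine riemannHypothesis_of_ne_zero fun ρ h1 h2 =>
    riemannZeta_ne_zero_of_stieltjesSeries_nonneg (fun u hu => ?_) h1 h2
  rw [stieltjesSeries, abs_of_pos hu]
  exact tsum_div_nonneg_of_sineSeries_nonneg abs_liouvilleHom_le_one hsine hu
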